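/- **Conventions.** All vector spaces are over a field $\mathbb K$. A Hom-vector space is a vector space $V$ with a linear map $\alpha_V:V\to V$; its homomorphisms are the linear maps commuting with the maps $\alpha$. A Hom-Leibniz algebra is a Hom-vector space $(\mathfrak g,\alpha)$ with a bilinear product satisfying $[\alpha(x),[y,z]]=[[x,y],\alpha(z)]-[[x,z],\alpha(y)]$ and $\alpha[x,y]=[\alpha(x),\alpha(y)]$; it is free if it is free over some Hom-vector space (left adjoint of the forgetful functor). Ideals are two-sided and $\alpha$-stable. For ideals $\mathfrak m,\mathfrak n$ of $\mathfrak g$, $[\mathfrak m,\mathfrak n]$ is the span of all $[m,n]$ and $[n,m]$ ($m\in\mathfrak m$, $n\in\mathfrak n$). The tensor product $\mathfrak m\ast\mathfrak n$ of ideals $\mathfrak m,\mathfrak n$ of $\mathfrak g$ is the Hom-Leibniz algebra generated by symbols $m\ast n$ and $n\ast m$ ($m\in\mathfrak m$, $n\in\mathfrak n$), bilinear in $m,n$, with $\alpha$ acting on both entries of a symbol, subject to the following relations for $m,m'\in\mathfrak m$ and $n,n'\in\mathfrak n$, together with those obtained by exchanging the roles of $\mathfrak m$ and $\mathfrak n$: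 - $\alpha(m)\ast[m',n]=-\alpha(m)\ast[n,m']$; - $\alpha(m)\ast[n,n']=[m,n]\ast\alpha(n')-[m,n']\ast\alpha(n)$; - $[m,m']\ast\alpha(n)=[m,n]\ast\alpha(m')-\alpha(m)\ast[n,m']$, where $[m,n]$ and $[n,m']$ are taken in $\mathfrak n$; - the product of two symbols $a\ast b$ and $c\ast d$ is $[a,b]\ast[c,d]$, both when $[a,b]$ is taken in $\mathfrak m$ and $[c,d]$ in $\mathfrak n$, and when $[a,b]$ is taken in $\mathfrak n$ and $[c,d]$ in $\mathfrak m$. The exterior product $\mathfrak m\curlywedge\mathfrak n$ is the quotient of $\mathfrak m\ast\mathfrak n$ by the span of all $m\ast n'-n\ast m'$ with $m=n$ and $m'=n'$ in $\mathfrak g$. The commutator map $\mathfrak m\curlywedge\mathfrak n\to\mathfrak g$ sends $m\curlywedge n\mapsto[m,n]$ and $n\curlywedge m\mapsto[n,m]$. $HL_n^\alpha(\mathfrak g)$ is the $n$-th homology, with trivial coefficients, of the complex $\cdots\to\mathfrak g^{\otimes3}\xrightarrow{d_3}\mathfrak g^{\otimes2}\xrightarrow{d_2}\mathfrak g\xrightarrow{0}\mathbb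 K$, where $d_2(x\otimes y)=-[x,y]$ and $d_3(x\otimes y\otimes z)=-[x,y]\otimes\alpha(z)+[x,z]\otimes\alpha(y)+\alpha(x)\otimes[y,z]$. It is a Hom-vector space via $\alpha^{\otimes n}$. **Theorem 4.7.** Let $\mathfrak m\rightarrowtail\mathfrak k\overset{p}{\twoheadrightarrow}\mathfrak g$ be an extension of Hom-Leibniz algebras, with $\mathfrak m$ regarded as the ideal $\ker p$ of $\mathfrak k$. Let $\mathfrak r\rightarrowtail\mathfrak f\overset{\pi}{\twoheadrightarrow}\mathfrak k$ be a free presentation of $\mathfrak k$ ($\mathfrak f$ free, $\mathfrak r=\ker\pi$), and let $\mathfrak s=\pi^{-1}(\mathfrak m)$, so that $\pi$ induces $\mathfrak s/\mathfrak r\cong\mathfrak m$. Then there is an exact sequence of Hom-vector spaces $$\ker(\mathfrak r\curlywedge\mathfrak f\to\mathfrak f)\xrightarrow{f_1}\ker(\mathfrak s\curlywedge\mathfrak f\to\mathfrak f)\xrightarrow{f_2}\ker(\mathfrak m\curlywedge\mathfrak k\to\mathfrak k)\xrightarrow{f_3}HL_2^\alpha(\mathfrak k)\xrightarrow{f_4}HL_2^\alpha(\mathfrak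 g)\xrightarrow{f_5}\mathfrak m/[\mathfrak m,\mathfrak k]\xrightarrow{f_6}HL_1^\alpha(\mathfrak k)\overset{f_7}{\twoheadrightarrow}HL_1^\alpha(\mathfrak g).$$ Here $f_1,f_2,f_4,f_6,f_7$ are induced by $\mathfrak r\subseteq\mathfrak s$, $\pi$, $p$, $\mathfrak m\subseteq\mathfrak k$ and $p$ respectively; $f_3$ is induced by $x\curlywedge y\mapsto x\otimes y$; and $f_5$ sends the class of $\sum_i p(x_i)\otimes p(y_i)$ to the class of $\sum_i[x_i,y_i]$. If moreover the extension splits (there is a homomorphism $\eta:\mathfrak g\to\mathfrak k$ of Hom-Leibniz algebras with $p\eta=\mathrm{id}$), then $f_3$ is injective and $f_4$ is surjective, so that $$\ker(\mathfrak m\curlywedge\mathfrak k\to\mathfrak k)\overset{f_3}{\rightarrowtail}HL_2^\alpha(\mathfrak k)\overset{f_4}{\twoheadrightarrow}HL_2^\alpha(\mathfrak g)$$ is a short exact sequence of Hom-vector spaces. -/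

import Mathlib

open scoped TensorProduct

universe u

namespace HomLeib

/-- A Hom-vector space: a vector space with a linear self-map. -/
class HomVect (K : Type*) (V : Type*) [Field K] [AddCommGroup V] [Module K V] where
  twist : V →ₗ[K] V

/-- The structure map of a Hom-vector space. -/
abbrev tw (K : Type*) {V : Type*} [Field K] [AddCommGroup V] [Module K V] [HomVect K V] :
    V →ₗ[K] V := HomVect.twist

/-- A (multiplicative) Hom-Leibniz algebra. -/
class HomLeibniz (K : Type*) (L : Type*) [Field K] [AddCommGroup L] [Module K L]
    extends HomVect K L where
  bracket : L →ₗ[K] L →ₗ[K] L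
  hom_leibniz : ∀ x y z : L,
    bracket (twist x) (bracket y z) =
      bracket (bracket x y) (twist z) - bracket (bracket x z) (twist y)
  twist_bracket : ∀ x y : L, twist (bracket x y) = bracket (twist x) (twist y)

/-- The product of a Hom-Leibniz algebra. -/
abbrev br (K : Type*) {L : Type*} [Field K] [AddCommGroup L] [Module K L] [HomLeibniz K L] :
    L →ₗ[K] L →ₗ[K] L := HomLeibniz.bracket

section Basic

variable (K : Type*) [Field K]

/-- Homomorphisms of Hom-vector spaces. -/
structure HomVectHom (V W : Type*) [AddCommGroup V] [Module K V] [HomVect K V]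
    [AddCommGroup W] [Module K W] [HomVect K W] extends V →ₗ[K] W where
  map_twist : ∀ x, toLinearMap (tw K x) = tw K (toLinearMap x)

instance (V W : Type*) [AddCommGroup V] [Module K V] [HomVect K V]
    [AddCommGroup W] [Module K W] [HomVect K W] :
    CoeFun (HomVectHom K V W) (fun _ => V → W) := ⟨fun f => ⇑f.toLinearMap⟩

/-- Homomorphisms of Hom-Leibniz algebras. -/
structure HomLeibnizHom (L L' : Type*) [AddCommGroup L] [Module K L] [HomLeibniz K L]
    [AddCommGroup L'] [Module K L'] [HomLeibniz K L'] extends HomVectHom K L L' where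
  map_br : ∀ x y, toLinearMap (br K x y) = br K (toLinearMap x) (toLinearMap y)

instance (L L' : Type*) [AddCommGroup L] [Module K L] [HomLeibniz K L]
    [AddCommGroup L'] [Module K L'] [HomLeibniz K L'] :
    CoeFun (HomLeibnizHom K L L') (fun _ => L → L') := ⟨fun f => ⇑f.toLinearMap⟩

/-- The identity homomorphism. -/
def HomLeibnizHom.id (L : Type*) [AddCommGroup L] [Module K L] [HomLeibniz K L] :
    HomLeibnizHom K L L where
  toLinearMap := LinearMap.id
  map_twist _ := rfl
  map_br _ _ := rfl

/-- `F` is a free Hom-Leibniz algebra: it has the universal property of the value of the left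
adjoint of the forgetful functor (to Hom-vector spaces) at some Hom-vector space `V`. -/
def IsFreeHomLeibniz (F : Type u) [AddCommGroup F] [Module K F] [HomLeibniz K F] : Prop :=
  ∃ (V : Type u) (_ : AddCommGroup V) (_ : Module K V) (_ : HomVect K V) (ι : HomVectHom K V F),
    ∀ (L : Type u) [AddCommGroup L] [Module K L] [HomLeibniz K L] (f : HomVectHom K V L),
      ∃! φ : HomLeibnizHom K F L, ∀ v, φ (ι v) = f v

/-- Two-sided ideals of a Hom-Leibniz algebra. -/
structure HomIdeal (L : Type*) [AddCommGroup L] [Module K L] [HomLeibniz K L]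
    extends Submodule K L where
  twist_mem : ∀ x ∈ toSubmodule, tw K x ∈ toSubmodule
  br_mem_right : ∀ x ∈ toSubmodule, ∀ y, br K x y ∈ toSubmodule
  br_mem_left : ∀ x ∈ toSubmodule, ∀ y, br K y x ∈ toSubmodule

end Basic

section Ideals

variable {K : Type*} [Field K] {L : Type*} [AddCommGroup L] [Module K L] [HomLeibniz K L]

namespace HomIdeal

/-- The whole algebra as an ideal of itself. -/
def top (K : Type*) [Field K] (L : Type*) [AddCommGroup L] [Module K L] [HomLeibniz K L] :
    HomIdeal K L where
  toSubmodule := ⊤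
  twist_mem _ _ := trivial
  br_mem_right _ _ _ := trivial
  br_mem_left _ _ _ := trivial

variable (M : HomIdeal K L)

/-- The structure map of `L` restricted to the ideal `M`. -/
def tws : M.toSubmodule →ₗ[K] M.toSubmodule := (tw K).restrict M.twist_mem

/-- The product `[m, x]` as an element of the ideal `M`, for `m` in `M` and `x` in `L`. -/
def mulR (m : M.toSubmodule) (x : L) : M.toSubmodule := ⟨br K (m : L) x, M.br_mem_right _ m.2 x⟩

/-- The product `[x, m]` as an element of the ideal `M`, for `m` in `M` and `x` in `L`. -/
def mulL (x : L) (m : M.toSubmodule) : M.toSubmodule := ⟨br K x (m : L), M.br_mem_left _ m.2 x⟩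

instance : HomVect K M.toSubmodule := ⟨M.tws⟩

@[simp] lemma coe_tws (m : M.toSubmodule) : (M.tws m : L) = tw K (m : L) := rfl
@[simp] lemma coe_mulR (m : M.toSubmodule) (x : L) : (M.mulR m x : L) = br K (m : L) x := rfl
@[simp] lemma coe_mulL (x : L) (m : M.toSubmodule) : (M.mulL x m : L) = br K x (m : L) := rfl

end HomIdeal

/-! ### The commutator of two ideals -/

/-- The (Higgins) commutator of two ideals: generated by all products `[m, n]` and `[n, m]`.
Their linear span is stable under the structure map and under the product
(`twist_mem_homComm`, `br_mem_homComm`), so it is the subalgebra they generate. -/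
def homComm (M N : HomIdeal K L) : Submodule K L :=
  Submodule.span K {x | ∃ m ∈ M.toSubmodule, ∃ n ∈ N.toSubmodule, x = br K m n ∨ x = br K n m}

lemma homComm_le (M N : HomIdeal K L) :
    homComm M N ≤ M.toSubmodule ⊓ N.toSubmodule := by
  refine Submodule.span_le.2 ?_
  rintro x ⟨m, hm, n, hn, rfl | rfl⟩
  · exact ⟨M.br_mem_right _ hm _, N.br_mem_left _ hn _⟩
  · exact ⟨M.br_mem_left _ hm _, N.br_mem_right _ hn _⟩

lemma br_mem_homComm (M N : HomIdeal K L) {x y : L} (hx : x ∈ homComm M N)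
    (hy : y ∈ homComm M N) : br K x y ∈ homComm M N :=
  Submodule.subset_span ⟨x, (homComm_le M N hx).1, y, (homComm_le M N hy).2, Or.inl rfl⟩

lemma twist_mem_homComm (M N : HomIdeal K L) {x : L} (hx : x ∈ homComm M N) :
    tw K x ∈ homComm M N := by
  have : homComm M N ≤ (homComm M N).comap (tw K) := by
    refine Submodule.span_le.2 ?_
    rintro x ⟨m, hm, n, hn, rfl | rfl⟩
    · exact Submodule.subset_span
        ⟨_, M.twist_mem _ hm, _, N.twist_mem _ hn, Or.inl (HomLeibniz.twist_bracket _ _)⟩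
    · exact Submodule.subset_span
        ⟨_, M.twist_mem _ hm, _, N.twist_mem _ hn, Or.inr (HomLeibniz.twist_bracket _ _)⟩
  exact this hx

/-- The Hom-vector space `M / [M, L]`. -/
abbrev ModComm (M : HomIdeal K L) : Type _ :=
  M.toSubmodule ⧸ (homComm M (HomIdeal.top K L)).submoduleOf M.toSubmodule

instance (M : HomIdeal K L) : HomVect K (ModComm M) :=
  ⟨Submodule.mapQ _ _ M.tws fun _ hx => twist_mem_homComm _ _ hx⟩

/-! ### The exterior product of two ideals

For ideals `M`, `N` of `L` the inclusions are crossed modules and `M`, `N` act on each other by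
the product of `L`. The tensor product of `M` and `N` is the Hom-Leibniz algebra generated by
symbols `m ∗ n` and `n ∗ m`, bilinear in `m` and `n`, modulo relations, and the exterior product is
its quotient by the elements `m ∗ n' - n ∗ m'` with `m = n` and `m' = n'` in `L`. Since the
relations express every product of two symbols as a symbol, the symbols span it linearly; it is
therefore realised as a quotient of `(M ⊗ N) × (N ⊗ M)`, and it is given its product below. -/

/-- The space of the symbols `m ∗ n` and `n ∗ m`. -/
abbrev Symb (M N : HomIdeal K L) : Type _ :=
  (M.toSubmodule ⊗[K] N.toSubmodule) × (N.toSubmodule ⊗[K] M.toSubmodule)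

section Exterior

variable (M N : HomIdeal K L)

/-- The symbol `m ∗ n`. -/
def symL (m : M.toSubmodule) (n : N.toSubmodule) : Symb M N := (m ⊗ₜ n, 0)

/-- The symbol `n ∗ m`. -/
def symR (n : N.toSubmodule) (m : M.toSubmodule) : Symb M N := (0, n ⊗ₜ m)

/-- The defining relations of the exterior product (each listed element becomes zero). The
relations `r5` say that the two expressions of the product of two symbols agree, the relation
`sq` passes from the tensor product to the exterior product. -/
inductive ExtRel : Symb M N → Prop
  | r3a (m m' : M.toSubmodule) (n : N.toSubmodule) :
      ExtRel (symL M N (M.tws m) (N.mulL m' n) + symL M N (M.tws m) (N.mulR n m'))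
  | r3b (n n' : N.toSubmodule) (m : M.toSubmodule) :
      ExtRel (symR M N (N.tws n) (M.mulL n' m) + symR M N (N.tws n) (M.mulR m n'))
  | r4a (m : M.toSubmodule) (n n' : N.toSubmodule) :
      ExtRel (symL M N (M.tws m) (N.mulR n n') -
        (symL M N (M.mulR m n) (N.tws n') - symL M N (M.mulR m n') (N.tws n)))
  | r4b (n : N.toSubmodule) (m m' : M.toSubmodule) :
      ExtRel (symR M N (N.tws n) (M.mulR m m') -
        (symR M N (N.mulR n m) (M.tws m') - symR M N (N.mulR n m') (M.tws m)))
  | r4c (m m' : M.toSubmodule) (n : N.toSubmodule) :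
      ExtRel (symL M N (M.mulR m m') (N.tws n) -
        (symR M N (N.mulL m n) (M.tws m') - symL M N (M.tws m) (N.mulR n m')))
  | r4d (n n' : N.toSubmodule) (m : M.toSubmodule) :
      ExtRel (symR M N (N.mulR n n') (M.tws m) -
        (symL M N (M.mulL n m) (N.tws n') - symR M N (N.tws n) (M.mulR m n')))
  | r5a (m m' : M.toSubmodule) (n n' : N.toSubmodule) :
      ExtRel (symL M N (M.mulR m n) (N.mulL m' n') - symR M N (N.mulL m n) (M.mulR m' n'))
  | r5b (m m' : M.toSubmodule) (n n' : N.toSubmodule) :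
      ExtRel (symL M N (M.mulL n m) (N.mulR n' m') - symR M N (N.mulR n m) (M.mulL n' m'))
  | r5c (m m' : M.toSubmodule) (n n' : N.toSubmodule) :
      ExtRel (symL M N (M.mulR m n) (N.mulR n' m') - symR M N (N.mulL m n) (M.mulL n' m'))
  | r5d (m m' : M.toSubmodule) (n n' : N.toSubmodule) :
      ExtRel (symL M N (M.mulL n m) (N.mulL m' n') - symR M N (N.mulR n m) (M.mulR m' n'))
  | sq (m m' : M.toSubmodule) (n n' : N.toSubmodule) (h : (m : L) = n) (h' : (m' : L) = n') :
      ExtRel (symL M N m n' - symR M N n m')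

/-- The subspace spanned by the relations. -/
def extRelSpan : Submodule K (Symb M N) := Submodule.span K {a | ExtRel M N a}

/-- The exterior product of two ideals. -/
abbrev ExtProd : Type _ := Symb M N ⧸ extRelSpan M N

/-- The class in the exterior product of a linear combination of symbols. -/
abbrev ExtProd.mk : Symb M N →ₗ[K] ExtProd M N := (extRelSpan M N).mkQ

/-- The map to `L ⊗ L` with `m ∗ n ↦ m ⊗ n` and `n ∗ m ↦ n ⊗ m`. -/
def symToTensor : Symb M N →ₗ[K] L ⊗[K] L :=
  (TensorProduct.map M.subtype N.subtype).coprod (TensorProduct.map N.subtype M.subtype)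

/-- The product of `L` as a linear map on `L ⊗ L`. -/
def mulMap (K L : Type*) [Field K] [AddCommGroup L] [Module K L] [HomLeibniz K L] :
    L ⊗[K] L →ₗ[K] L := TensorProduct.lift (br K)

@[simp] lemma mulMap_symL (m : M.toSubmodule) (n : N.toSubmodule) :
    mulMap K L (symToTensor M N (symL M N m n)) = br K (m : L) (n : L) := by
  simp [mulMap, symToTensor, symL]

@[simp] lemma mulMap_symR (n : N.toSubmodule) (m : M.toSubmodule) :
    mulMap K L (symToTensor M N (symR M N n m)) = br K (n : L) (m : L) := by
  simp [mulMap, symToTensor, symR]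

lemma extRelSpan_le_ker :
    extRelSpan M N ≤ LinearMap.ker (mulMap K L ∘ₗ symToTensor M N) := by
  refine Submodule.span_le.2 ?_
  intro a ha
  simp only [SetLike.mem_coe, LinearMap.mem_ker, LinearMap.comp_apply]
  induction ha with
  | sq m m' n n' h h' => simp [h, h']
  | _ => simp [HomLeibniz.hom_leibniz]

/-- The commutator map `λ` to `L`, with `m ⋏ n ↦ [m, n]` and `n ⋏ m ↦ [n, m]`. -/
def lam : ExtProd M N →ₗ[K] L :=
  (extRelSpan M N).liftQ (mulMap K L ∘ₗ symToTensor M N) (extRelSpan_le_ker M N)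

/-- The structure map on symbols. -/
def symTwist : Symb M N →ₗ[K] Symb M N :=
  (TensorProduct.map M.tws N.tws).prodMap (TensorProduct.map N.tws M.tws)

@[simp] lemma symTwist_symL (m : M.toSubmodule) (n : N.toSubmodule) :
    symTwist M N (symL M N m n) = symL M N (M.tws m) (N.tws n) := by
  simp [symTwist, symL]

@[simp] lemma symTwist_symR (n : N.toSubmodule) (m : M.toSubmodule) :
    symTwist M N (symR M N n m) = symR M N (N.tws n) (M.tws m) := by
  simp [symTwist, symR]

lemma tws_mulR (m : M.toSubmodule) (n : N.toSubmodule) :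
    M.tws (M.mulR m (n : L)) = M.mulR (M.tws m) (N.tws n : L) :=
  Subtype.ext (HomLeibniz.twist_bracket _ _)

lemma tws_mulL (n : N.toSubmodule) (m : M.toSubmodule) :
    M.tws (M.mulL (n : L) m) = M.mulL (N.tws n : L) (M.tws m) :=
  Subtype.ext (HomLeibniz.twist_bracket _ _)

set_option linter.unusedSimpArgs false in
lemma extRel_twist {a : Symb M N} (ha : ExtRel M N a) : ExtRel M N (symTwist M N a) := by
  cases ha
  case sq m m' n n' h h' =>
    rw [map_sub, symTwist_symL, symTwist_symR]
    exact ExtRel.sq _ _ _ _ (by simp [h]) (by simp [h'])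
  all_goals
    simp only [map_add, map_sub, symTwist_symL, symTwist_symR, tws_mulR N M, tws_mulR M N,
      tws_mulR M M, tws_mulR N N, tws_mulL N M, tws_mulL M N]
  exacts [ExtRel.r3a _ _ _, ExtRel.r3b _ _ _, ExtRel.r4a _ _ _, ExtRel.r4b _ _ _,
    ExtRel.r4c _ _ _, ExtRel.r4d _ _ _, ExtRel.r5a _ _ _ _, ExtRel.r5b _ _ _ _,
    ExtRel.r5c _ _ _ _, ExtRel.r5d _ _ _ _]

instance : HomVect K (ExtProd M N) :=
  ⟨Submodule.mapQ _ _ (symTwist M N) <| Submodule.span_le.2 fun _ ha =>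
    Submodule.subset_span (extRel_twist M N ha)⟩

lemma lam_twist (a : ExtProd M N) : lam M N (tw K a) = tw K (lam M N a) := by
  have h : (mulMap K L ∘ₗ symToTensor M N) ∘ₗ symTwist M N
      = tw K ∘ₗ (mulMap K L ∘ₗ symToTensor M N) := by
    ext m n <;>
      simp [mulMap, symToTensor, symTwist, HomLeibniz.twist_bracket]
  obtain ⟨a, rfl⟩ := Submodule.mkQ_surjective _ a
  exact LinearMap.congr_fun h a

lemma lam_mem (a : ExtProd M N) : lam M N a ∈ M.toSubmodule ⊓ N.toSubmodule := by
  have h : ∀ a : Symb M N,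
      mulMap K L (symToTensor M N a) ∈ M.toSubmodule ⊓ N.toSubmodule := by
    rintro ⟨a, b⟩
    have ha : ∀ a : M.toSubmodule ⊗[K] N.toSubmodule,
        mulMap K L (symToTensor M N (a, 0)) ∈ M.toSubmodule ⊓ N.toSubmodule := fun a => by
      induction a with
      | zero =>
        rw [show ((0, 0) : Symb M N) = 0 from rfl, map_zero, map_zero]
        exact zero_mem _
      | tmul m n =>
        rw [show ((m ⊗ₜ n, 0) : Symb M N) = symL M N m n from rfl, mulMap_symL]
        exact ⟨M.br_mem_right _ m.2 _, N.br_mem_left _ n.2 _⟩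
      | add x y hx hy =>
        rw [show ((x + y, 0) : Symb M N) = (x, 0) + (y, 0) by simp, map_add, map_add]
        exact add_mem hx hy
    have hb : ∀ b : N.toSubmodule ⊗[K] M.toSubmodule,
        mulMap K L (symToTensor M N (0, b)) ∈ M.toSubmodule ⊓ N.toSubmodule := fun b => by
      induction b with
      | zero =>
        rw [show ((0, 0) : Symb M N) = 0 from rfl, map_zero, map_zero]
        exact zero_mem _
      | tmul n m =>
        rw [show ((0, n ⊗ₜ m) : Symb M N) = symR M N n m from rfl, mulMap_symR]
        exact ⟨M.br_mem_left _ m.2 _, N.br_mem_right _ n.2 _⟩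
      | add x y hx hy =>
        rw [show ((0, x + y) : Symb M N) = (0, x) + (0, y) by simp, map_add, map_add]
        exact add_mem hx hy
    rw [show ((a, b) : Symb M N) = (a, 0) + (0, b) by simp, map_add, map_add]
    exact add_mem (ha a) (hb b)
  obtain ⟨a, rfl⟩ := Submodule.mkQ_surjective _ a
  exact h a

/-- The commutator map with values in `M`. -/
def lamM : ExtProd M N →ₗ[K] M.toSubmodule := (lam M N).codRestrict _ fun a => (lam_mem M N a).1

/-- The commutator map with values in `N`. -/
def lamN : ExtProd M N →ₗ[K] N.toSubmodule := (lam M N).codRestrict _ fun a => (lam_mem M N a).2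

/-- The class `m ⋏ n`, bilinear in `m` and `n`. -/
def wedgeL : M.toSubmodule →ₗ[K] N.toSubmodule →ₗ[K] ExtProd M N :=
  (TensorProduct.mk K M.toSubmodule N.toSubmodule).compr₂ (ExtProd.mk M N ∘ₗ LinearMap.inl K _ _)

lemma wedgeL_apply (m : M.toSubmodule) (n : N.toSubmodule) :
    wedgeL M N m n = ExtProd.mk M N (symL M N m n) := rfl

/-- The exterior product is a Hom-Leibniz algebra, with
`[m ⋏ n, m' ⋏ n'] = [m, n] ⋏ [m', n']` and likewise for the other symbols. -/
instance : HomLeibniz K (ExtProd M N) where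
  bracket := (wedgeL M N).compl₁₂ (lamM M N) (lamN M N)
  hom_leibniz a b c := by
    have tM : ∀ x, lamM M N (tw K x) = M.tws (lamM M N x) := fun x =>
      Subtype.ext (lam_twist M N x)
    have tN : ∀ x, lamN M N (tw K x) = N.tws (lamN M N x) := fun x =>
      Subtype.ext (lam_twist M N x)
    simp only [LinearMap.compl₁₂_apply, tM, tN, wedgeL_apply]
    rw [← map_sub, ← sub_eq_zero, ← map_sub]
    exact (Submodule.Quotient.mk_eq_zero _).2 (Submodule.subset_span (ExtRel.r4a _ _ _))
  twist_bracket a b := by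
    have tM : ∀ x, lamM M N (tw K x) = M.tws (lamM M N x) := fun x =>
      Subtype.ext (lam_twist M N x)
    have tN : ∀ x, lamN M N (tw K x) = N.tws (lamN M N x) := fun x =>
      Subtype.ext (lam_twist M N x)
    simp only [LinearMap.compl₁₂_apply, tM, tN, wedgeL_apply]
    rw [← symTwist_symL]
    rfl

/-- The kernel of the commutator map `M ⋏ N → L`. -/
abbrev KerLam : Submodule K (ExtProd M N) := LinearMap.ker (lam M N)

instance : HomVect K (KerLam M N) :=
  ⟨(tw K).restrict fun a ha => by
    rw [LinearMap.mem_ker] at ha ⊢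
    rw [lam_twist, ha, map_zero]⟩

end Exterior

/-- The map on symbols induced by a homomorphism `φ` that carries `M` to `M'` and `N` to `N'`:
`m ∗ n ↦ φ m ∗ φ n` and `n ∗ m ↦ φ n ∗ φ m`. -/
def symMap {L' : Type*} [AddCommGroup L'] [Module K L'] [HomLeibniz K L']
    (φ : HomLeibnizHom K L L') {M N : HomIdeal K L} {M' N' : HomIdeal K L'}
    (hM : ∀ x ∈ M.toSubmodule, φ x ∈ M'.toSubmodule)
    (hN : ∀ x ∈ N.toSubmodule, φ x ∈ N'.toSubmodule) : Symb M N →ₗ[K] Symb M' N' :=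
  (TensorProduct.map (φ.toLinearMap.restrict hM) (φ.toLinearMap.restrict hN)).prodMap
    (TensorProduct.map (φ.toLinearMap.restrict hN) (φ.toLinearMap.restrict hM))

/-! ### Homology with trivial coefficients in degrees one and two

The complex ends in `L ⊗ L ⊗ L → L ⊗ L → L → K`, where the last map is zero because the
coefficients are trivial. -/

section Homology

variable (K L)

/-- The boundary map `d₂ (x ⊗ y) = -[x, y]`. -/
def d2 : L ⊗[K] L →ₗ[K] L := -mulMap K L

/-- The boundary map
`d₃ (x ⊗ y ⊗ z) = -[x, y] ⊗ α z + [x, z] ⊗ α y + α x ⊗ [y, z]`. -/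
def d3 : (L ⊗[K] L) ⊗[K] L →ₗ[K] L ⊗[K] L :=
  -TensorProduct.map (mulMap K L) (tw K)
    + TensorProduct.map (mulMap K L) (tw K) ∘ₗ
        (TensorProduct.rightComm K L L L).toLinearMap
    + TensorProduct.map (tw K) (mulMap K L) ∘ₗ (TensorProduct.assoc K L L L).toLinearMap

lemma d3_tmul (x y z : L) : d3 K L ((x ⊗ₜ y) ⊗ₜ z) =
    -(br K x y ⊗ₜ tw K z) + br K x z ⊗ₜ tw K y + tw K x ⊗ₜ br K y z := by
  simp [d3, mulMap]

lemma d2_comp_d3 : d2 K L ∘ₗ d3 K L = 0 := by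
  ext x y z
  simp [d3_tmul, d2, mulMap, HomLeibniz.hom_leibniz]

/-- The structure map of `L ⊗ L`. -/
abbrev twT : L ⊗[K] L →ₗ[K] L ⊗[K] L := TensorProduct.map (tw K) (tw K)

lemma d2_twist (t : L ⊗[K] L) : d2 K L (twT K L t) = tw K (d2 K L t) := by
  have h : d2 K L ∘ₗ twT K L = tw K ∘ₗ d2 K L := by
    ext x y
    simp [d2, mulMap, HomLeibniz.twist_bracket]
  exact LinearMap.congr_fun h t

lemma d3_twist (t : (L ⊗[K] L) ⊗[K] L) :
    d3 K L (TensorProduct.map (twT K L) (tw K) t) = twT K L (d3 K L t) := by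
  have h : d3 K L ∘ₗ TensorProduct.map (twT K L) (tw K) = twT K L ∘ₗ d3 K L := by
    ext x y z
    simp [d3_tmul, HomLeibniz.twist_bracket]
  exact LinearMap.congr_fun h t

/-- The first homology `L / Im d₂`. -/
abbrev HL1 : Type _ := L ⧸ LinearMap.range (d2 K L)

instance : HomVect K (HL1 K L) :=
  ⟨Submodule.mapQ _ _ (tw K) (by rintro _ ⟨t, rfl⟩; exact ⟨twT K L t, d2_twist K L t⟩)⟩

/-- The 2-cycles. -/
abbrev Z2 : Submodule K (L ⊗[K] L) := LinearMap.ker (d2 K L)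

/-- The structure map on 2-cycles. -/
def Z2.twist : Z2 K L →ₗ[K] Z2 K L :=
  (twT K L).restrict fun t ht => by
    rw [LinearMap.mem_ker] at ht ⊢
    rw [d2_twist, ht, map_zero]

/-- The second homology `ker d₂ / Im d₃`. -/
abbrev HL2 : Type _ := Z2 K L ⧸ (LinearMap.range (d3 K L)).submoduleOf (Z2 K L)

instance : HomVect K (HL2 K L) :=
  ⟨Submodule.mapQ _ _ (Z2.twist K L) (by
    rintro ⟨_, h⟩ ⟨t, rfl⟩
    exact ⟨TensorProduct.map (twT K L) (tw K) t, d3_twist K L t⟩)⟩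

/-- The homology class of a 2-cycle. -/
abbrev HL2.mk : Z2 K L →ₗ[K] HL2 K L := Submodule.mkQ _

end Homology

end Ideals

end HomLeib

open HomLeib

/-! For a surjection `p : k → g` with kernel `m`, let the relative complex be the kernel of the map
induced by `p` from the Leibniz complex of `k` to that of `g`. The idea is that `m ⋏ k` is its
degree two part modulo boundaries, that is, `ker (p ⊗ p) / d₃ (ker (p ⊗ p ⊗ p))`.

Three facts give this. Symbols with tensor zero are already relations, because `m ⊗ k` and `k ⊗ m`
meet in `m ⊗ m` inside `k ⊗ k` and the square relations identify the two copies of `m ⊗ m`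
(`mem_extRelSpan_of_symToTensor_eq_zero`). The symbols cover `ker (p ⊗ p)` (`range_symToTensor`).
The relations cover exactly `d₃ (ker (p ⊗ p ⊗ p))` (`map_extRelSpan`). They combine in
`mk_extProd_eq_zero`, the criterion behind almost every later step.

Hence `ker (m ⋏ k → k)` is the second relative homology, and `m / [m, k]` is the first. From `f₃`
on, the sequence is the long exact homology sequence of the pair `k → g`, with the usual diagram
chases. For the composable surjections `F → k → g` the three relative complexes form a short exact
sequence, which gives exactness between `f₁` and `f₂`. The composite `f₃ f₂` factors through the
second homology of `F`, which vanishes because `F` is free (`IsFreeHomLeibniz.exists_d3_eq`). A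
splitting of `p` induces a chain section, so the long exact sequence breaks up. -/

namespace HomLeib

/-! ### Factoring maps through surjections -/

section Induced

variable {K : Type*} [Field K]

/-- A homomorphism out of `A` that vanishes on the kernel of a surjection `q : A → B` factors
through `q`, as a homomorphism of Hom-vector spaces. -/
lemma exists_homVectHom_of_surjective {A B C : Type*} [AddCommGroup A] [Module K A]
    [AddCommGroup B] [Module K B] [HomVect K B] [AddCommGroup C] [Module K C] [HomVect K C]
    (t : A →ₗ[K] A) (q : A →ₗ[K] B) (f : A →ₗ[K] C) (hq : Function.Surjective q)
    (hqt : ∀ a, q (t a) = tw K (q a)) (hft : ∀ a, f (t a) = tw K (f a))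
    (h : ∀ a, q a = 0 → f a = 0) :
    ∃ φ : HomVectHom K B C, ∀ a, φ (q a) = f a := by
  -- The linear section `s` need not commute with the structure maps. The composite `f ∘ s` does,
  -- since by `h` it depends only on the class and not on the chosen lift.
  obtain ⟨s, hs⟩ := q.exists_rightInverse_of_surjective (LinearMap.range_eq_top.2 hq)
  have hsq : ∀ a, f (s (q a)) = f a := fun a => by
    rw [← sub_eq_zero, ← map_sub]
    apply h
    rw [map_sub, sub_eq_zero]
    exact LinearMap.congr_fun hs (q a)
  refine ⟨⟨f ∘ₗ s, fun x => ?_⟩, hsq⟩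
  obtain ⟨a, rfl⟩ := hq x
  rw [← hqt, LinearMap.comp_apply, LinearMap.comp_apply, hsq, hsq, hft]

end Induced

/-! ### Naturality of the Leibniz complex -/

section Cube

variable {K : Type*} [Field K] {L : Type*} [AddCommGroup L] [Module K L] [HomLeibniz K L]
variable {L' : Type*} [AddCommGroup L'] [Module K L'] [HomLeibniz K L']

/-- The map `φ ⊗ φ`. -/
abbrev sqMap {V W : Type*} [AddCommGroup V] [Module K V] [AddCommGroup W] [Module K W]
    (φ : V →ₗ[K] W) : V ⊗[K] V →ₗ[K] W ⊗[K] W := TensorProduct.map φ φ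

/-- The map `φ ⊗ φ ⊗ φ`. -/
abbrev cubeMap {V W : Type*} [AddCommGroup V] [Module K V] [AddCommGroup W] [Module K W]
    (φ : V →ₗ[K] W) : (V ⊗[K] V) ⊗[K] V →ₗ[K] (W ⊗[K] W) ⊗[K] W :=
  TensorProduct.map (sqMap φ) φ

lemma mulMap_sqMap (φ : HomLeibnizHom K L L') (t : L ⊗[K] L) :
    mulMap K L' (sqMap φ.toLinearMap t) = φ (mulMap K L t) := by
  have h : mulMap K L' ∘ₗ sqMap φ.toLinearMap = φ.toLinearMap ∘ₗ mulMap K L := by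
    ext x y
    simp [mulMap, φ.map_br]
  exact LinearMap.congr_fun h t

lemma d3_cubeMap (φ : HomLeibnizHom K L L') (w : (L ⊗[K] L) ⊗[K] L) :
    d3 K L' (cubeMap φ.toLinearMap w) = sqMap φ.toLinearMap (d3 K L w) := by
  have h : d3 K L' ∘ₗ cubeMap φ.toLinearMap = sqMap φ.toLinearMap ∘ₗ d3 K L := by
    ext x y z
    simp [d3_tmul, φ.map_br, φ.map_twist]
  exact LinearMap.congr_fun h w

lemma twT_sqMap (φ : HomVectHom K L L') (t : L ⊗[K] L) :
    twT K L' (sqMap φ.toLinearMap t) = sqMap φ.toLinearMap (twT K L t) := by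
  have h : twT K L' ∘ₗ sqMap φ.toLinearMap = sqMap φ.toLinearMap ∘ₗ twT K L := by
    ext x y
    simp [φ.map_twist]
  exact LinearMap.congr_fun h t

lemma mulMap_twT (t : L ⊗[K] L) : mulMap K L (twT K L t) = tw K (mulMap K L t) := by
  simpa [d2] using d2_twist K L t

lemma mulMap_d3 (w : (L ⊗[K] L) ⊗[K] L) : mulMap K L (d3 K L w) = 0 := by
  simpa [d2] using LinearMap.congr_fun (d2_comp_d3 K L) w

lemma mem_Z2 {t : L ⊗[K] L} : t ∈ Z2 K L ↔ mulMap K L t = 0 := by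
  simp [d2]

lemma mk_HL2_eq_zero {t : Z2 K L} : HL2.mk K L t = 0 ↔ ∃ w, d3 K L w = t :=
  Submodule.Quotient.mk_eq_zero _

end Cube

/-! ### Symbols and their tensors under homomorphisms -/

section Functoriality

variable {K : Type*} [Field K] {L : Type*} [AddCommGroup L] [Module K L] [HomLeibniz K L]
variable {L' : Type*} [AddCommGroup L'] [Module K L'] [HomLeibniz K L']

lemma symToTensor_symMap (φ : HomLeibnizHom K L L') {M N : HomIdeal K L} {M' N' : HomIdeal K L'}
    (hM : ∀ x ∈ M.toSubmodule, φ x ∈ M'.toSubmodule)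
    (hN : ∀ x ∈ N.toSubmodule, φ x ∈ N'.toSubmodule) (a : Symb M N) :
    symToTensor M' N' (symMap φ hM hN a) = sqMap φ.toLinearMap (symToTensor M N a) := by
  have h : symToTensor M' N' ∘ₗ symMap φ hM hN = sqMap φ.toLinearMap ∘ₗ symToTensor M N := by
    ext x y <;> simp [symToTensor, symMap, LinearMap.restrict_apply]
  exact LinearMap.congr_fun h a

lemma symToTensor_symTwist (M N : HomIdeal K L) (a : Symb M N) :
    symToTensor M N (symTwist M N a) = twT K L (symToTensor M N a) := by
  have h : symToTensor M N ∘ₗ symTwist M N = twT K L ∘ₗ symToTensor M N := by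
    ext x y <;> simp [symToTensor, symTwist]
  exact LinearMap.congr_fun h a

lemma symMap_symTwist (φ : HomLeibnizHom K L L') {M N : HomIdeal K L} {M' N' : HomIdeal K L'}
    (hM : ∀ x ∈ M.toSubmodule, φ x ∈ M'.toSubmodule)
    (hN : ∀ x ∈ N.toSubmodule, φ x ∈ N'.toSubmodule) (a : Symb M N) :
    symMap φ hM hN (symTwist M N a) = symTwist M' N' (symMap φ hM hN a) := by
  have tM : ∀ x, φ.toLinearMap.restrict hM (M.tws x) = M'.tws (φ.toLinearMap.restrict hM x) :=
    fun x => Subtype.ext (φ.map_twist x)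
  have tN : ∀ x, φ.toLinearMap.restrict hN (N.tws x) = N'.tws (φ.toLinearMap.restrict hN x) :=
    fun x => Subtype.ext (φ.map_twist x)
  have h : symMap φ hM hN ∘ₗ symTwist M N = symTwist M' N' ∘ₗ symMap φ hM hN := by
    ext x y <;> simp [symMap, symTwist, tM, tN]
  exact LinearMap.congr_fun h a

end Functoriality

/-! ### The exterior product as relative chains modulo boundaries -/

section Kernel

variable {K : Type*} [Field K] {L : Type*} [AddCommGroup L] [Module K L] [HomLeibniz K L]
lemma symToTensor_symL (M N : HomIdeal K L) (m : M.toSubmodule) (n : N.toSubmodule) :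
    symToTensor M N (symL M N m n) = (m : L) ⊗ₜ (n : L) := by
  simp [symToTensor, symL]

lemma symToTensor_symR (M N : HomIdeal K L) (n : N.toSubmodule) (m : M.toSubmodule) :
    symToTensor M N (symR M N n m) = (n : L) ⊗ₜ (m : L) := by
  simp [symToTensor, symR]

/-- Symbols of `M ≤ N` with the same tensor agree modulo the relations `m ∗ m' = m ∗ m'`
that identify the two kinds of symbols with both entries in `M`. -/
lemma mem_extRelSpan_of_symToTensor_eq_zero {M N : HomIdeal K L}
    (hMN : M.toSubmodule ≤ N.toSubmodule) (a : Symb M N)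
    (ha : symToTensor M N a = 0) : a ∈ extRelSpan M N := by
  obtain ⟨b, c⟩ := a
  -- A linear retraction of `L` onto `M`. It makes the equality of `(M ⊗ N) ∩ (N ⊗ M)` with `M ⊗ M`
  -- explicit: `e` recovers the element of `M ⊗ M`, while `iL` and `iR` embed it as the two kinds of
  -- symbols.
  obtain ⟨q, hq⟩ := M.toSubmodule.subtype.exists_leftInverse_of_injective
    M.toSubmodule.ker_subtype
  have hq' : ∀ x : M.toSubmodule, q x = x := fun x => LinearMap.congr_fun hq x
  have hbc : TensorProduct.map M.toSubmodule.subtype N.toSubmodule.subtype b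
      + TensorProduct.map N.toSubmodule.subtype M.toSubmodule.subtype c = 0 := ha
  have injL : Function.Injective
      (TensorProduct.map M.toSubmodule.subtype N.toSubmodule.subtype) :=
    TensorProduct.map_injective_of_flat_flat _ _ M.toSubmodule.subtype_injective
      N.toSubmodule.subtype_injective
  have injR : Function.Injective
      (TensorProduct.map N.toSubmodule.subtype M.toSubmodule.subtype) :=
    TensorProduct.map_injective_of_flat_flat _ _ N.toSubmodule.subtype_injective
      M.toSubmodule.subtype_injective
  let j := Submodule.inclusion hMN
  let e : M.toSubmodule ⊗[K] N.toSubmodule →ₗ[K] M.toSubmodule ⊗[K] M.toSubmodule :=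
    TensorProduct.map LinearMap.id (q ∘ₗ N.toSubmodule.subtype)
  let iL : M.toSubmodule ⊗[K] M.toSubmodule →ₗ[K] M.toSubmodule ⊗[K] N.toSubmodule :=
    TensorProduct.map LinearMap.id j
  let iR : M.toSubmodule ⊗[K] M.toSubmodule →ₗ[K] N.toSubmodule ⊗[K] M.toSubmodule :=
    TensorProduct.map j LinearMap.id
  let Q : L ⊗[K] L →ₗ[K] L ⊗[K] L :=
    TensorProduct.map LinearMap.id (M.toSubmodule.subtype ∘ₗ q)
  have h1 : Q ∘ₗ TensorProduct.map M.toSubmodule.subtype N.toSubmodule.subtype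
      = TensorProduct.map M.toSubmodule.subtype N.toSubmodule.subtype ∘ₗ iL ∘ₗ e := by
    ext x y
    simp [Q, iL, e, j]
  have h2 : Q ∘ₗ TensorProduct.map N.toSubmodule.subtype M.toSubmodule.subtype
      = TensorProduct.map N.toSubmodule.subtype M.toSubmodule.subtype := by
    ext x y
    simp [Q, hq']
  have h3 : TensorProduct.map M.toSubmodule.subtype N.toSubmodule.subtype ∘ₗ iL
      = TensorProduct.map N.toSubmodule.subtype M.toSubmodule.subtype ∘ₗ iR := by
    ext x y
    simp [iL, iR, j]
  -- The tensors of `b` and `c` are opposite. Projecting the second factor to `M` by `Q` fixes the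
  -- tensor of `c`, hence also that of `b`, so `b` comes from `M ⊗ M`.
  have hb : iL (e b) = b := by
    apply injL
    have := congrArg Q hbc
    rw [map_add, map_zero, ← LinearMap.comp_apply, h1, ← LinearMap.comp_apply, h2] at this
    exact (eq_neg_of_add_eq_zero_left this).trans (eq_neg_of_add_eq_zero_left hbc).symm
  have hc : c = -iR (e b) := by
    apply injR
    rw [map_neg, ← LinearMap.comp_apply, ← h3, LinearMap.comp_apply, hb]
    exact eq_neg_of_add_eq_zero_right hbc
  have key : ∀ t : M.toSubmodule ⊗[K] M.toSubmodule,
      ((iL t, -iR t) : Symb M N) ∈ extRelSpan M N := fun t => by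
    induction t with
    | zero =>
      rw [map_zero, map_zero, neg_zero]
      exact zero_mem _
    | tmul x y =>
      have := ExtRel.sq (M := M) (N := N) x y (j x) (j y) rfl rfl
      have h : ((iL (x ⊗ₜ y), -iR (x ⊗ₜ y)) : Symb M N)
          = symL M N x (j y) - symR M N (j x) y := by
        simp [symL, symR, iL, iR]
      rw [h]
      exact Submodule.subset_span this
    | add x y hx hy =>
      have h : ((iL (x + y), -iR (x + y)) : Symb M N) = (iL x, -iR x) + (iL y, -iR y) := by
        simp [add_comm]
      rw [h]
      exact add_mem hx hy
  have := key (e b)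
  rwa [hb, ← hc] at this

variable {M : HomIdeal K L} {Q : Type*} [AddCommGroup Q] [Module K Q] {p : L →ₗ[K] Q}

/-- Right exactness of the tensor product: `ker (p ⊗ p)` is `M ⊗ L + L ⊗ M`, and the two summands
are the tensors of the two kinds of symbols. -/
lemma range_symToTensor (hp : Function.Surjective p) (hM : ∀ x, x ∈ M.toSubmodule ↔ p x = 0) :
    LinearMap.range (symToTensor M (HomIdeal.top K L)) =
      LinearMap.ker (TensorProduct.map p p) := by
  apply le_antisymm
  · rw [LinearMap.range_le_ker_iff]
    ext x y
    · simp [symToTensor, (hM _).1 x.2]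
    · simp [symToTensor, (hM _).1 y.2]
  · have hex : Function.Exact M.toSubmodule.subtype p := fun x => by
      simp [← hM]
    rw [TensorProduct.map_ker hex hp hex hp]
    refine sup_le ?_ ?_
    · rintro _ ⟨t, rfl⟩
      induction t with
      | zero => simp
      | tmul x y =>
        exact ⟨symR M _ ⟨x, Submodule.mem_top⟩ y, by simp [symToTensor_symR]⟩
      | add x y hx hy => rw [map_add]; exact add_mem hx hy
    · rintro _ ⟨t, rfl⟩
      induction t with
      | zero => simp
      | tmul x y =>
        exact ⟨symL M _ x ⟨y, Submodule.mem_top⟩, by simp [symToTensor_symL]⟩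
      | add x y hx hy => rw [map_add]; exact add_mem hx hy

/-- Each slot has its own relation: `r4a` is the boundary with first entry in `M`, and `r4d` the one
with second entry in `M`. The third slot is reduced to the second by `r3b`. -/
lemma d3_tmul_mem_map_extRelSpan {x y z : L}
    (h : x ∈ M.toSubmodule ∨ y ∈ M.toSubmodule ∨ z ∈ M.toSubmodule) :
    d3 K L ((x ⊗ₜ y) ⊗ₜ z) ∈
      (extRelSpan M (HomIdeal.top K L)).map (symToTensor M (HomIdeal.top K L)) := by
  set T := HomIdeal.top K L
  have mem : ∀ {a}, ExtRel M T a → symToTensor M T a ∈ (extRelSpan M T).map (symToTensor M T) :=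
    fun ha => Submodule.mem_map_of_mem (Submodule.subset_span ha)
  let i : L → T.toSubmodule := fun x => ⟨x, Submodule.mem_top⟩
  have r4d : ∀ (x : L) (y : M.toSubmodule) (z : L), symToTensor M T
      (symR M T (T.mulR (i x) (i z)) (M.tws y) - (symL M T (M.mulL (i x) y) (T.tws (i z))
        - symR M T (T.tws (i x)) (M.mulR y (i z)))) = d3 K L ((x ⊗ₜ (y : L)) ⊗ₜ z) :=
    fun x y z => by
        rw [d3_tmul]
        simp only [map_sub, symToTensor_symL, symToTensor_symR, HomIdeal.coe_tws,
          HomIdeal.coe_mulR, HomIdeal.coe_mulL, i]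
        abel
  rcases h with h | h | h
  · have := mem (ExtRel.r4a ⟨x, h⟩ (i y) (i z))
    convert this using 1
    rw [d3_tmul]
    simp only [map_sub, symToTensor_symL, HomIdeal.coe_tws, HomIdeal.coe_mulR, i]
    abel
  · rw [← r4d x ⟨y, h⟩ z]
    exact mem (ExtRel.r4d (i x) (i z) ⟨y, h⟩)
  -- The boundaries of `x ⊗ y ⊗ z` and `x ⊗ z ⊗ y` add up to `α x ⊗ ([y, z] + [z, y])`, which is the
  -- relation `r3b`.
  · have h3 := mem (ExtRel.r3b (i x) (i y) ⟨z, h⟩)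
    have h4 := mem (ExtRel.r4d (i x) (i y) ⟨z, h⟩)
    convert sub_mem h3 h4 using 1
    rw [r4d x ⟨z, h⟩ y, d3_tmul, d3_tmul]
    simp only [map_add, symToTensor_symR, HomIdeal.coe_tws, HomIdeal.coe_mulR,
      HomIdeal.coe_mulL, i]
    abel

/-- The relations `r4` are boundaries of pure tensors with an entry in `M`, the relations `r3` are
sums of two such boundaries, and `r5` and `sq` have tensor zero. Conversely, the kernel on the
triple tensor product is spanned by pure tensors with an entry in `M`. -/
lemma map_extRelSpan (hp : Function.Surjective p) (hM : ∀ x, x ∈ M.toSubmodule ↔ p x = 0) :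
    (extRelSpan M (HomIdeal.top K L)).map (symToTensor M (HomIdeal.top K L)) =
      (LinearMap.ker (TensorProduct.map (TensorProduct.map p p) p)).map (d3 K L) := by
  set T := HomIdeal.top K L
  apply le_antisymm
  · rw [extRelSpan, Submodule.map_span_le]
    have hp0 : ∀ x : M.toSubmodule, p x = 0 := fun x => (hM _).1 x.2
    have hd : ∀ x y z : L, p x = 0 ∨ p y = 0 ∨ p z = 0 → d3 K L ((x ⊗ₜ y) ⊗ₜ z) ∈
        (LinearMap.ker (TensorProduct.map (TensorProduct.map p p) p)).map (d3 K L) :=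
      fun x y z h => Submodule.mem_map_of_mem (by
        rcases h with h | h | h <;> simp [h])
    intro a ha
    induction ha with
    | r3a m m' n =>
      convert add_mem (hd m m' n (.inl (hp0 m))) (hd m n m' (.inl (hp0 m))) using 1
      simp only [map_add, symToTensor_symL, d3_tmul, HomIdeal.coe_tws, HomIdeal.coe_mulR,
        HomIdeal.coe_mulL]
      abel
    | r3b n n' m =>
      convert add_mem (hd n n' m (.inr (.inr (hp0 m)))) (hd n m n' (.inr (.inl (hp0 m)))) using 1
      simp only [map_add, symToTensor_symR, d3_tmul, HomIdeal.coe_tws, HomIdeal.coe_mulR,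
        HomIdeal.coe_mulL]
      abel
    | r4a m n n' =>
      convert hd m n n' (.inl (hp0 m)) using 1
      simp only [map_sub, symToTensor_symL, d3_tmul, HomIdeal.coe_tws, HomIdeal.coe_mulR]
      abel
    | r4b n m m' =>
      convert hd n m m' (.inr (.inl (hp0 m))) using 1
      simp only [map_sub, symToTensor_symR, d3_tmul, HomIdeal.coe_tws, HomIdeal.coe_mulR]
      abel
    | r4c m m' n =>
      convert hd m n m' (.inl (hp0 m)) using 1
      simp only [map_sub, symToTensor_symL, symToTensor_symR, d3_tmul, HomIdeal.coe_tws,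
        HomIdeal.coe_mulR, HomIdeal.coe_mulL]
      abel
    | r4d n n' m =>
      convert hd n m n' (.inr (.inl (hp0 m))) using 1
      simp only [map_sub, symToTensor_symL, symToTensor_symR, d3_tmul, HomIdeal.coe_tws,
        HomIdeal.coe_mulR, HomIdeal.coe_mulL]
      abel
    | sq m m' n n' h h' => simp [symToTensor_symL, symToTensor_symR, h, h']
    | _ => simp [symToTensor_symL, symToTensor_symR]
  · have hex : Function.Exact M.toSubmodule.subtype p := fun x => by
      simp [← hM]
    -- With the kernel of `p ⊗ p` known, the formula for the kernel of a tensor product of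
    -- surjections applies again, now to `(p ⊗ p) ⊗ p`.
    have hex2 : Function.Exact (symToTensor M T) (TensorProduct.map p p) :=
      LinearMap.exact_iff.2 (range_symToTensor hp hM).symm
    rw [Submodule.map_le_iff_le_comap,
      TensorProduct.map_ker hex2 (TensorProduct.map_surjective hp hp) hex hp]
    refine sup_le ?_ ?_
    · rintro _ ⟨t, rfl⟩
      induction t with
      | zero => simp
      | tmul x y =>
        induction x with
        | zero => simp
        | tmul x x' => exact d3_tmul_mem_map_extRelSpan (.inr (.inr y.2))
        | add x x' hx hx' => rw [TensorProduct.add_tmul, map_add]; exact add_mem hx hx'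
      | add x y hx hy => rw [map_add]; exact add_mem hx hy
    · rintro _ ⟨t, rfl⟩
      induction t with
      | zero => simp
      | tmul x y =>
        obtain ⟨b, c⟩ := x
        have hb : symToTensor M T (b, c)
            = TensorProduct.map M.toSubmodule.subtype T.toSubmodule.subtype b
            + TensorProduct.map T.toSubmodule.subtype M.toSubmodule.subtype c := by
          simp [symToTensor]
        rw [LinearMap.rTensor_tmul, hb, TensorProduct.add_tmul]
        refine add_mem ?_ ?_
        · induction b with
          | zero => simp
          | tmul x x' => exact d3_tmul_mem_map_extRelSpan (.inl x.2)
          | add x x' hx hx' =>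
            rw [map_add, TensorProduct.add_tmul]
            exact add_mem (hx (by simp [symToTensor])) (hx' (by simp [symToTensor]))
        · clear hb
          induction c with
          | zero => simp
          | tmul x x' => exact d3_tmul_mem_map_extRelSpan (.inr (.inl x'.2))
          | add x x' hx hx' =>
            rw [map_add, TensorProduct.add_tmul]
            exact add_mem hx hx'
      | add x y hx hy => rw [map_add]; exact add_mem hx hy

/-- The working form of the identification with relative chains: questions about the exterior
product become questions about boundaries in `L ⊗ L`. The converse holds because symbols with equal
tensors differ by a relation. -/
lemma mk_extProd_eq_zero (hp : Function.Surjective p)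
    (hM : ∀ x, x ∈ M.toSubmodule ↔ p x = 0) {a : Symb M (HomIdeal.top K L)} :
    ExtProd.mk M (HomIdeal.top K L) a = 0 ↔
      ∃ w, TensorProduct.map (TensorProduct.map p p) p w = 0 ∧
        d3 K L w = symToTensor M (HomIdeal.top K L) a := by
  have h : ExtProd.mk M (HomIdeal.top K L) a = 0 ↔ a ∈ extRelSpan M (HomIdeal.top K L) :=
    Submodule.Quotient.mk_eq_zero _
  have h' : (∃ w, TensorProduct.map (TensorProduct.map p p) p w = 0 ∧
      d3 K L w = symToTensor M (HomIdeal.top K L) a) ↔ symToTensor M (HomIdeal.top K L) a ∈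
      (LinearMap.ker (TensorProduct.map (TensorProduct.map p p) p)).map (d3 K L) := Iff.rfl
  rw [h, h', ← map_extRelSpan hp hM]
  refine ⟨Submodule.mem_map_of_mem, ?_⟩
  rintro ⟨b, hb, hab⟩
  have := mem_extRelSpan_of_symToTensor_eq_zero le_top (a - b) (by rw [map_sub, hab, sub_self])
  simpa using add_mem this hb

end Kernel

/-! ### Vanishing of the second homology of a free algebra -/

section Free

variable {K : Type*} [Field K]

/-- A Hom-vector space with the zero product. -/
@[reducible] def abelian (V : Type*) [AddCommGroup V] [Module K V] [HomVect K V] :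
    HomLeibniz K V where
  bracket := 0
  hom_leibniz _ _ _ := by simp
  twist_bracket _ _ := by simp

variable {F : Type*} [AddCommGroup F] [Module K F] [HomLeibniz K F]
  {H : Type*} [AddCommGroup H] [Module K H] [HomVect K H]

/-- The extension of `F` by `H` with product `[(x, h), (y, h')] = ([x, y], c (x ⊗ y))` and
structure map `(x, h) ↦ (α x, α h + γ x)`. -/
@[reducible] def cocycleExtension (c : F ⊗[K] F →ₗ[K] H) (γ : F →ₗ[K] H)
    (hc : c ∘ₗ d3 K F = 0)
    (hγ : ∀ t, γ (mulMap K F t) = c (twT K F t) - tw K (c t)) : HomLeibniz K (F × H) where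
  twist := (tw K ∘ₗ LinearMap.fst K F H).prod
    (tw K ∘ₗ LinearMap.snd K F H + γ ∘ₗ LinearMap.fst K F H)
  bracket := (TensorProduct.curry ((mulMap K F).prod c)).compl₁₂
    (LinearMap.fst K F H) (LinearMap.fst K F H)
  hom_leibniz := by
    rintro ⟨x, _⟩ ⟨y, _⟩ ⟨z, _⟩
    have h := LinearMap.congr_fun hc ((x ⊗ₜ y) ⊗ₜ z)
    simp only [LinearMap.comp_apply, d3_tmul, map_add, map_neg, LinearMap.zero_apply] at h
    refine Prod.ext ?_ ?_
    · simp [mulMap, HomLeibniz.hom_leibniz]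
    · change c (tw K x ⊗ₜ br K y z) = c (br K x y ⊗ₜ tw K z) - c (br K x z ⊗ₜ tw K y)
      rw [← sub_eq_zero, ← h]
      abel
  twist_bracket := by
    rintro ⟨x, _⟩ ⟨y, _⟩
    have h := hγ (x ⊗ₜ y)
    simp only [mulMap, TensorProduct.lift.tmul] at h
    refine Prod.ext ?_ ?_
    · simp [mulMap, HomLeibniz.twist_bracket]
    · simp [mulMap, h]

/-- The second homology of a free Hom-Leibniz algebra vanishes. -/
lemma IsFreeHomLeibniz.exists_d3_eq {F : Type u} [AddCommGroup F] [Module K F] [HomLeibniz K F]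
    (hF : IsFreeHomLeibniz K F) {t : F ⊗[K] F} (ht : mulMap K F t = 0) :
    ∃ w, d3 K F w = t := by
  obtain ⟨V, _, _, _, ι, hι⟩ := hF
  -- The generators `ι V` meet `[F, F]` trivially.
  obtain ⟨ρ, hρι, hρ⟩ : ∃ ρ : F →ₗ[K] V, (∀ v, ρ (ι v) = v) ∧ ∀ t, ρ (mulMap K F t) = 0 := by
    let _ := abelian (K := K) V
    obtain ⟨φ, hφ, -⟩ := hι V ⟨LinearMap.id, fun _ => rfl⟩
    refine ⟨φ.toLinearMap, hφ, fun t => ?_⟩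
    have h : φ.toLinearMap ∘ₗ mulMap K F = 0 := by
      ext x y
      exact φ.map_br x y
    exact LinearMap.congr_fun h t
  -- A linear retraction of `F ⊗ F` modulo boundaries onto the homology.
  obtain ⟨c, hc⟩ := LinearMap.exists_extend (HL2.mk K F)
  replace hc : ∀ t (h : t ∈ Z2 K F), c t = HL2.mk K F ⟨t, h⟩ := fun t h =>
    LinearMap.congr_fun hc ⟨t, h⟩
  have hc3 : c ∘ₗ d3 K F = 0 := LinearMap.ext fun w => by
    have h : d3 K F w ∈ Z2 K F := LinearMap.congr_fun (d2_comp_d3 K F) w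
    rw [LinearMap.comp_apply, hc _ h]
    exact (Submodule.Quotient.mk_eq_zero _).2 ⟨w, rfl⟩
  -- The extension `c` need not commute with the structure maps, but its defect vanishes on cycles,
  -- where `c` is the class map. So the defect factors through the product, and the factor extends
  -- linearly to all of `F`.
  obtain ⟨γ₀, hγ₀⟩ : ∃ γ₀ : F →ₗ[K] HL2 K F,
      ∀ t, γ₀ (mulMap K F t) = c (twT K F t) - tw K (c t) := by
    obtain ⟨s, hs⟩ := (mulMap K F).rangeRestrict.exists_rightInverse_of_surjective
      (LinearMap.range_rangeRestrict _)
    obtain ⟨γ₀, hγ₀⟩ := LinearMap.exists_extend ((c ∘ₗ twT K F - tw K ∘ₗ c) ∘ₗ s)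
    refine ⟨γ₀, fun t => ?_⟩
    have h0 : ∀ t ∈ Z2 K F, (c ∘ₗ twT K F - tw K ∘ₗ c) t = 0 := fun t h => by
      have h' : twT K F t ∈ Z2 K F := (Z2.twist K F ⟨t, h⟩).2
      rw [LinearMap.sub_apply, LinearMap.comp_apply, LinearMap.comp_apply, hc _ h, hc _ h',
        sub_eq_zero]
      rfl
    have h1 := LinearMap.congr_fun hγ₀ ((mulMap K F).rangeRestrict t)
    have h2 := congrArg Subtype.val (LinearMap.congr_fun hs ((mulMap K F).rangeRestrict t))
    have h3 := h0 (s ((mulMap K F).rangeRestrict t) - t) (by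
      simp only [d2, LinearMap.mem_ker, LinearMap.neg_apply, map_sub, sub_eq_zero]
      exact congrArg Neg.neg h2)
    rw [map_sub, sub_eq_zero] at h3
    exact h1.trans h3
  -- The correction does not change `γ₀` on products, since `ρ` kills them, and makes it vanish on
  -- the generators. This is what lets `v ↦ (ι v, 0)` commute with the twisted structure map.
  let γ : F →ₗ[K] HL2 K F := γ₀ - γ₀ ∘ₗ ι.toLinearMap ∘ₗ ρ
  have hγ : ∀ t, γ (mulMap K F t) = c (twT K F t) - tw K (c t) := fun t => by
    simp [γ, hρ, hγ₀]
  have hγι : ∀ v, γ (ι v) = 0 := fun v => by simp [γ, hρι]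
  let _ := cocycleExtension c γ hc3 hγ
  let j : HomVectHom K V (F × HL2 K F) :=
    ⟨LinearMap.inl K F (HL2 K F) ∘ₗ ι.toLinearMap, fun v => Prod.ext (ι.map_twist v) (by
      change 0 = tw K (0 : HL2 K F) + γ (ι v)
      rw [hγι, map_zero, add_zero])⟩
  obtain ⟨σ, hσ, -⟩ := hι (F × HL2 K F) j
  let pr : HomLeibnizHom K (F × HL2 K F) F :=
    ⟨⟨LinearMap.fst K F (HL2 K F), fun _ => rfl⟩, fun x y => by
      change mulMap K F (x.1 ⊗ₜ y.1) = _
      simp [mulMap]⟩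
  -- By the uniqueness half of freeness, `σ` splits the extension: its first component is an
  -- endomorphism that fixes the generators.
  have hpr : ∀ x, (σ x).1 = x := by
    obtain ⟨φ, -, hφ⟩ := hι F ι
    let τ : HomLeibnizHom K F F :=
      ⟨⟨pr.toLinearMap ∘ₗ σ.toLinearMap, fun x => by
        simp only [LinearMap.comp_apply, σ.map_twist, pr.map_twist]⟩, fun x y => by
        simp only [LinearMap.comp_apply, σ.map_br, pr.map_br]⟩
    have h1 := hφ τ fun v => congrArg Prod.fst (hσ v)
    have h2 := hφ (HomLeibnizHom.id K F) fun v => rfl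
    intro x
    exact congrArg (fun f : HomLeibnizHom K F F => f x) (h1.trans h2.symm)
  -- The second component of `σ [x, y] = [σ x, σ y]` exhibits the cocycle as a coboundary. Hence `c`
  -- vanishes on tensors with zero product, where it is also the homology class.
  have hs : LinearMap.snd K F (HL2 K F) ∘ₗ σ.toLinearMap ∘ₗ mulMap K F = c := by
    ext x y
    have h := congrArg Prod.snd (σ.map_br x y)
    change _ = c ((σ x).1 ⊗ₜ (σ y).1) at h
    rw [hpr, hpr] at h
    simpa [mulMap] using h
  have h0 : c t = 0 := by
    rw [← hs, LinearMap.comp_apply, LinearMap.comp_apply, ht, map_zero, map_zero]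
  have htz : t ∈ Z2 K F := by simp [d2, ht]
  rw [hc t htz] at h0
  exact (Submodule.Quotient.mk_eq_zero _).1 h0

end Free

/-! ### Construction of the seven maps -/

section Maps

variable {K : Type*} [Field K] {L : Type*} [AddCommGroup L] [Module K L] [HomLeibniz K L]
variable {L' : Type*} [AddCommGroup L'] [Module K L'] [HomLeibniz K L']

lemma extRel_symMap (φ : HomLeibnizHom K L L') {M N : HomIdeal K L} {M' N' : HomIdeal K L'}
    (hM : ∀ x ∈ M.toSubmodule, φ x ∈ M'.toSubmodule)
    (hN : ∀ x ∈ N.toSubmodule, φ x ∈ N'.toSubmodule) {a : Symb M N} (ha : ExtRel M N a) :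
    ExtRel M' N' (symMap φ hM hN a) := by
  let φM := φ.toLinearMap.restrict hM
  let φN := φ.toLinearMap.restrict hN
  have sL : ∀ x y, symMap φ hM hN (symL M N x y) = symL M' N' (φM x) (φN y) := fun x y => by
    simp [symMap, symL, φM, φN]
  have sR : ∀ x y, symMap φ hM hN (symR M N x y) = symR M' N' (φN x) (φM y) := fun x y => by
    simp [symMap, symR, φM, φN]
  have tM : ∀ x, φM (M.tws x) = M'.tws (φM x) := fun x => Subtype.ext (φ.map_twist x)
  have tN : ∀ x, φN (N.tws x) = N'.tws (φN x) := fun x => Subtype.ext (φ.map_twist x)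
  have rM : ∀ x y, φM (M.mulR x y) = M'.mulR (φM x) (φ y) := fun x y =>
    Subtype.ext (φ.map_br x y)
  have rN : ∀ x y, φN (N.mulR x y) = N'.mulR (φN x) (φ y) := fun x y =>
    Subtype.ext (φ.map_br x y)
  have lM : ∀ x y, φM (M.mulL x y) = M'.mulL (φ x) (φM y) := fun x y =>
    Subtype.ext (φ.map_br x y)
  have lN : ∀ x y, φN (N.mulL x y) = N'.mulL (φ x) (φN y) := fun x y =>
    Subtype.ext (φ.map_br x y)
  induction ha <;> simp only [map_add, map_sub, sL, sR, tM, tN, rM, rN, lM, lN]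
  case r3a m m' n => exact ExtRel.r3a (φM m) (φM m') (φN n)
  case r3b n n' m => exact ExtRel.r3b (φN n) (φN n') (φM m)
  case r4a m n n' => exact ExtRel.r4a (φM m) (φN n) (φN n')
  case r4b n m m' => exact ExtRel.r4b (φN n) (φM m) (φM m')
  case r4c m m' n => exact ExtRel.r4c (φM m) (φM m') (φN n)
  case r4d n n' m => exact ExtRel.r4d (φN n) (φN n') (φM m)
  case r5a m m' n n' => exact ExtRel.r5a (φM m) (φM m') (φN n) (φN n')
  case r5b m m' n n' => exact ExtRel.r5b (φM m) (φM m') (φN n) (φN n')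
  case r5c m m' n n' => exact ExtRel.r5c (φM m) (φM m') (φN n) (φN n')
  case r5d m m' n n' => exact ExtRel.r5d (φM m) (φM m') (φN n) (φN n')
  case sq m m' n n' h h' =>
    exact ExtRel.sq _ _ _ _ (congrArg φ.toLinearMap h) (congrArg φ.toLinearMap h')

variable (M N : HomIdeal K L)

/-- The combinations of symbols whose commutator vanishes. -/
abbrev symCycles : Submodule K (Symb M N) := LinearMap.ker (mulMap K L ∘ₗ symToTensor M N)

/-- The class of a combination of symbols with vanishing commutator. -/
def KerLam.mk : symCycles M N →ₗ[K] KerLam M N :=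
  (ExtProd.mk M N ∘ₗ (symCycles M N).subtype).codRestrict _ fun a => a.2

lemma KerLam.mk_surjective : Function.Surjective (KerLam.mk M N) := by
  rintro ⟨x, hx⟩
  obtain ⟨a, rfl⟩ := Submodule.mkQ_surjective _ x
  exact ⟨⟨a, hx⟩, rfl⟩

/-- The structure map on combinations of symbols with vanishing commutator. -/
def symCycles.twist : symCycles M N →ₗ[K] symCycles M N :=
  (symTwist M N).restrict fun a ha => by
    rw [LinearMap.mem_ker, LinearMap.comp_apply] at ha ⊢
    rw [symToTensor_symTwist, mulMap_twT, ha, map_zero]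

lemma KerLam.mk_twist (a : symCycles M N) :
    KerLam.mk M N (symCycles.twist M N a) = tw K (KerLam.mk M N a) := rfl

variable {M N}

/-- A homomorphism carrying `M` to `M'` and `N` to `N'` induces a map on kernels of commutator
maps. -/
lemma exists_kerLam_map (φ : HomLeibnizHom K L L') {M' N' : HomIdeal K L'}
    (hM : ∀ x ∈ M.toSubmodule, φ x ∈ M'.toSubmodule)
    (hN : ∀ x ∈ N.toSubmodule, φ x ∈ N'.toSubmodule) :
    ∃ f : HomVectHom K (KerLam M N) (KerLam M' N'),
      ∀ (a : Symb M N) (ha : ExtProd.mk _ _ a ∈ KerLam M N),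
        (f ⟨ExtProd.mk _ _ a, ha⟩ : ExtProd M' N') = ExtProd.mk _ _ (symMap φ hM hN a) := by
  have hc : ∀ a ∈ symCycles M N, symMap φ hM hN a ∈ symCycles M' N' := fun a ha => by
    rw [LinearMap.mem_ker, LinearMap.comp_apply] at ha ⊢
    rw [symToTensor_symMap, mulMap_sqMap, ha, map_zero]
  let g : symCycles M N →ₗ[K] symCycles M' N' := (symMap φ hM hN).restrict hc
  have hgt : ∀ a, KerLam.mk M' N' (g (symCycles.twist M N a)) = tw K (KerLam.mk M' N' (g a)) :=
    fun a => Subtype.ext (congrArg (ExtProd.mk M' N') (symMap_symTwist φ hM hN a))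
  have hg0 : ∀ a, KerLam.mk M N a = 0 → KerLam.mk M' N' (g a) = 0 := fun a ha => by
    have h : (a : Symb M N) ∈ extRelSpan M N :=
      (Submodule.Quotient.mk_eq_zero _).1 (congrArg Subtype.val ha)
    have h' : extRelSpan M N ≤ (extRelSpan M' N').comap (symMap φ hM hN) :=
      Submodule.span_le.2 fun b hb => Submodule.subset_span (extRel_symMap φ hM hN hb)
    exact Subtype.ext ((Submodule.Quotient.mk_eq_zero _).2 (h' h))
  obtain ⟨f, hf⟩ := exists_homVectHom_of_surjective (A := symCycles M N)
    (B := KerLam M N) (C := KerLam M' N') (symCycles.twist M N) (KerLam.mk M N)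
    (KerLam.mk M' N' ∘ₗ g) (KerLam.mk_surjective M N) (KerLam.mk_twist M N) hgt hg0
  exact ⟨f, fun a ha => congrArg Subtype.val (hf ⟨a, ha⟩)⟩

/-- Well defined because a combination of symbols that vanishes in the exterior product has a
boundary as its tensor. -/
lemma exists_kerLam_to_HL2 {Q : Type*} [AddCommGroup Q] [Module K Q] {p : L →ₗ[K] Q}
    (hp : Function.Surjective p) (hM : ∀ x, x ∈ M.toSubmodule ↔ p x = 0) :
    ∃ f : HomVectHom K (KerLam M (HomIdeal.top K L)) (HL2 K L),
      ∀ (a : Symb M (HomIdeal.top K L)) (ha : ExtProd.mk _ _ a ∈ KerLam M (HomIdeal.top K L))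
        (hz : symToTensor _ _ a ∈ Z2 K L),
        f ⟨ExtProd.mk _ _ a, ha⟩ = HL2.mk K L ⟨symToTensor _ _ a, hz⟩ := by
  have hc : ∀ a ∈ symCycles M (HomIdeal.top K L), symToTensor _ _ a ∈ Z2 K L :=
    fun a ha => mem_Z2.2 ha
  let g : symCycles M (HomIdeal.top K L) →ₗ[K] Z2 K L := (symToTensor _ _).restrict hc
  have hgt : ∀ a, HL2.mk K L (g (symCycles.twist M _ a)) = tw K (HL2.mk K L (g a)) :=
    fun a => congrArg (HL2.mk K L) (Subtype.ext (symToTensor_symTwist M _ a.1))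
  have hg0 : ∀ a, KerLam.mk M (HomIdeal.top K L) a = 0 → HL2.mk K L (g a) = 0 := fun a ha => by
    obtain ⟨w, -, hw⟩ := (mk_extProd_eq_zero (a := a.1) hp hM).1 (congrArg Subtype.val ha)
    exact mk_HL2_eq_zero.2 ⟨w, hw⟩
  obtain ⟨f, hf⟩ := exists_homVectHom_of_surjective (A := symCycles M (HomIdeal.top K L))
    (B := KerLam M (HomIdeal.top K L)) (C := HL2 K L) (symCycles.twist M _)
    (KerLam.mk M _) (HL2.mk K L ∘ₗ g) (KerLam.mk_surjective M _) (KerLam.mk_twist M _) hgt hg0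
  exact ⟨f, fun a ha _ => hf ⟨a, ha⟩⟩

lemma exists_HL2_map (φ : HomLeibnizHom K L L') :
    ∃ f : HomVectHom K (HL2 K L) (HL2 K L'),
      ∀ (t : Z2 K L) (hz : sqMap φ.toLinearMap (t : L ⊗[K] L) ∈ Z2 K L'),
        f (HL2.mk K L t) = HL2.mk K L' ⟨_, hz⟩ := by
  have hc : ∀ t ∈ Z2 K L, sqMap φ.toLinearMap t ∈ Z2 K L' := fun t ht => by
    rw [mem_Z2] at ht ⊢
    rw [mulMap_sqMap, ht, map_zero]
  obtain ⟨f, hf⟩ := exists_homVectHom_of_surjective (Z2.twist K L) (HL2.mk K L)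
    (HL2.mk K L' ∘ₗ (sqMap φ.toLinearMap).restrict hc) (Submodule.mkQ_surjective _)
    (fun _ => rfl)
    (fun t => congrArg (HL2.mk K L') (Subtype.ext (twT_sqMap φ.toHomVectHom t).symm))
    (fun t ht => by
      obtain ⟨w, hw⟩ := mk_HL2_eq_zero.1 ht
      exact mk_HL2_eq_zero.2 ⟨cubeMap φ.toLinearMap w, by rw [d3_cubeMap, hw]; rfl⟩)
  exact ⟨f, fun t _ => hf t⟩

lemma exists_HL1_map (φ : HomLeibnizHom K L L') :
    ∃ f : HomVectHom K (HL1 K L) (HL1 K L'),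
      ∀ x : L, f (Submodule.Quotient.mk x) = Submodule.Quotient.mk (φ x) :=
  exists_homVectHom_of_surjective (tw K) (Submodule.mkQ (LinearMap.range (d2 K L)))
    (Submodule.mkQ (LinearMap.range (d2 K L')) ∘ₗ φ.toLinearMap) (Submodule.mkQ_surjective _)
    (fun _ => rfl) (fun x => congrArg (Submodule.mkQ _) (φ.map_twist x))
    (fun x hx => by
      obtain ⟨t, rfl⟩ := (Submodule.Quotient.mk_eq_zero _).1 hx
      exact (Submodule.Quotient.mk_eq_zero _).2 ⟨sqMap φ.toLinearMap t, by
        rw [d2, d2, LinearMap.neg_apply, mulMap_sqMap, LinearMap.neg_apply, map_neg]⟩)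

/-- This makes `M / [M, L]` the first relative homology: a single tensor witnesses membership in the
commutator. -/
lemma homComm_top_eq_range :
    homComm M (HomIdeal.top K L) =
      LinearMap.range (mulMap K L ∘ₗ symToTensor M (HomIdeal.top K L)) := by
  apply le_antisymm
  · refine Submodule.span_le.2 ?_
    rintro x ⟨m, hm, n, hn, rfl | rfl⟩
    · exact ⟨symL M _ ⟨m, hm⟩ ⟨n, hn⟩, mulMap_symL _ _ _ _⟩
    · exact ⟨symR M _ ⟨n, hn⟩ ⟨m, hm⟩, mulMap_symR _ _ _ _⟩
  · rintro _ ⟨⟨b, c⟩, rfl⟩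
    have h : ((b, c) : Symb M (HomIdeal.top K L)) = (b, 0) + (0, c) := by simp
    rw [h, map_add]
    refine add_mem ?_ ?_
    · induction b with
      | zero => exact (map_zero (mulMap K L ∘ₗ symToTensor M (HomIdeal.top K L))).symm ▸ zero_mem _
      | tmul x y =>
        exact Submodule.subset_span ⟨x, x.2, y, y.2, .inl (mulMap_symL _ _ _ _)⟩
      | add x y hx hy =>
        have h : ((x + y, 0) : Symb M (HomIdeal.top K L)) = (x, 0) + (y, 0) := by simp
        rw [h, map_add]
        exact add_mem (hx (by simp)) (hy (by simp))
    · clear h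
      induction c with
      | zero => exact (map_zero (mulMap K L ∘ₗ symToTensor M (HomIdeal.top K L))).symm ▸ zero_mem _
      | tmul x y =>
        exact Submodule.subset_span ⟨y, y.2, x, x.2, .inr (mulMap_symR _ _ _ _)⟩
      | add x y hx hy =>
        have h : ((0, x + y) : Symb M (HomIdeal.top K L)) = (0, x) + (0, y) := by simp
        rw [h, map_add]
        exact add_mem hx hy

lemma mk_modComm_eq_zero {x : M.toSubmodule} :
    (Submodule.Quotient.mk x : ModComm M) = 0 ↔
      ∃ a, mulMap K L (symToTensor M (HomIdeal.top K L) a) = x := by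
  rw [Submodule.Quotient.mk_eq_zero, Submodule.submoduleOf, Submodule.mem_comap,
    homComm_top_eq_range]
  rfl

lemma exists_modComm_to_HL1 :
    ∃ f : HomVectHom K (ModComm M) (HL1 K L),
      ∀ x : M.toSubmodule, f (Submodule.Quotient.mk x) = Submodule.Quotient.mk (x : L) :=
  exists_homVectHom_of_surjective M.tws
    (Submodule.mkQ ((homComm M (HomIdeal.top K L)).submoduleOf M.toSubmodule))
    (Submodule.mkQ (LinearMap.range (d2 K L)) ∘ₗ M.toSubmodule.subtype)
    (Submodule.mkQ_surjective _) (fun _ => rfl) (fun _ => rfl)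
    (fun x hx => by
      obtain ⟨a, ha⟩ := mk_modComm_eq_zero.1 hx
      exact (Submodule.Quotient.mk_eq_zero _).2 ⟨-symToTensor M _ a, by
        rw [d2, LinearMap.neg_apply, map_neg, neg_neg, ha]; rfl⟩)

/-- The connecting homomorphism. -/
lemma exists_connecting {p : HomLeibnizHom K L L'} (hp : Function.Surjective p)
    (hM : ∀ x, x ∈ M.toSubmodule ↔ p x = 0) :
    ∃ f : HomVectHom K (HL2 K L') (ModComm M),
      ∀ (t : L ⊗[K] L) (hz : sqMap p.toLinearMap t ∈ Z2 K L')
        (ht : mulMap K L t ∈ M.toSubmodule),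
        f (HL2.mk K L' ⟨_, hz⟩) = Submodule.Quotient.mk ⟨mulMap K L t, ht⟩ := by
  -- These are exactly the tensors that `p ⊗ p` sends to cycles, so `A` maps onto the second
  -- homology of `L'` and the map can be defined on `A`.
  let A := M.toSubmodule.comap (mulMap K L)
  have hA : ∀ t ∈ A, twT K L t ∈ A := fun t ht => by
    change mulMap K L (twT K L t) ∈ M.toSubmodule
    rw [mulMap_twT]
    exact M.twist_mem _ ht
  have hZ : ∀ t, t ∈ A ↔ sqMap p.toLinearMap t ∈ Z2 K L' := fun t => by
    rw [mem_Z2, mulMap_sqMap]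
    exact hM _
  obtain ⟨f, hf⟩ := exists_homVectHom_of_surjective ((twT K L).restrict hA)
    (HL2.mk K L' ∘ₗ (sqMap p.toLinearMap).restrict fun t ht => (hZ t).1 ht)
    (Submodule.mkQ ((homComm M (HomIdeal.top K L)).submoduleOf M.toSubmodule) ∘ₗ
      (mulMap K L).restrict fun _ ht => ht)
    (fun x => by
      obtain ⟨⟨t', ht'⟩, rfl⟩ := Submodule.mkQ_surjective _ x
      obtain ⟨t, rfl⟩ := TensorProduct.map_surjective hp hp t'
      exact ⟨⟨t, (hZ t).2 ht'⟩, rfl⟩)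
    (fun t => congrArg (HL2.mk K L') (Subtype.ext (twT_sqMap p.toHomVectHom t).symm))
    (fun t => congrArg (Submodule.mkQ _) (Subtype.ext (mulMap_twT t.1)))
    (fun t ht => by
      obtain ⟨w', hw'⟩ := mk_HL2_eq_zero.1 ht
      obtain ⟨w, rfl⟩ := TensorProduct.map_surjective (TensorProduct.map_surjective hp hp) hp w'
      -- Subtracting a lifted boundary does not change the product, and what remains comes from
      -- symbols. The product of `t` is therefore in `[M, L]`.
      have h : t.1 - d3 K L w ∈ LinearMap.ker (sqMap p.toLinearMap) := by
        rw [LinearMap.mem_ker, map_sub, ← d3_cubeMap, sub_eq_zero]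
        exact hw'.symm
      rw [← range_symToTensor hp hM] at h
      obtain ⟨a, ha⟩ := h
      exact mk_modComm_eq_zero.2 ⟨a, by rw [ha, map_sub, mulMap_d3, sub_zero]; rfl⟩)
  exact ⟨f, fun t hz _ => hf ⟨t, (hZ t).2 hz⟩⟩

end Maps

/-! ### Exactness by diagram chases -/

section Exactness

variable {K : Type*} [Field K]
  {k : Type*} [AddCommGroup k] [Module K k] [HomLeibniz K k]
  {g : Type*} [AddCommGroup g] [Module K g] [HomLeibniz K g]
  {p : HomLeibnizHom K k g} {m : HomIdeal K k}

lemma sqMap_eq_zero {Q : Type*} [AddCommGroup Q] [Module K Q] {p : k →ₗ[K] Q}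
    (hp : Function.Surjective p) (hm : ∀ x, x ∈ m.toSubmodule ↔ p x = 0) {t : k ⊗[K] k} :
    TensorProduct.map p p t = 0 ↔ ∃ a, symToTensor m (HomIdeal.top K k) a = t :=
  (SetLike.ext_iff.1 (range_symToTensor hp hm) t).symm

lemma sqMap_mem_Z2 (p : HomLeibnizHom K k g) {t : k ⊗[K] k} (ht : t ∈ Z2 K k) :
    sqMap p.toLinearMap t ∈ Z2 K g := by
  rw [mem_Z2, mulMap_sqMap, mem_Z2.1 ht, map_zero]

lemma cubeMap_surjective {V W : Type*} [AddCommGroup V] [Module K V] [AddCommGroup W] [Module K W]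
    {φ : V →ₗ[K] W} (hφ : Function.Surjective φ) :
    Function.Surjective (cubeMap φ) :=
  TensorProduct.map_surjective (TensorProduct.map_surjective hφ hφ) hφ

/-- Exactness at the middle term for the kernels `r ≤ s` and `m` of a composable pair of
surjections and of the second of them. -/
lemma exact_kerLam_map {F : Type*} [AddCommGroup F] [Module K F] [HomLeibniz K F]
    (hp : Function.Surjective p) (hm : ∀ x, x ∈ m.toSubmodule ↔ p x = 0)
    {π : HomLeibnizHom K F k} (hπ : Function.Surjective π)
    {r s : HomIdeal K F} (hr : ∀ x, x ∈ r.toSubmodule ↔ π x = 0)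
    (hs : ∀ x, x ∈ s.toSubmodule ↔ π x ∈ m.toSubmodule)
    {hrs : ∀ x ∈ r.toSubmodule, HomLeibnizHom.id K F x ∈ s.toSubmodule}
    {hFF : ∀ x ∈ (HomIdeal.top K F).toSubmodule,
      HomLeibnizHom.id K F x ∈ (HomIdeal.top K F).toSubmodule}
    {hFk : ∀ x ∈ (HomIdeal.top K F).toSubmodule, π x ∈ (HomIdeal.top K k).toSubmodule}
    {f₁ : HomVectHom K (KerLam r (HomIdeal.top K F)) (KerLam s (HomIdeal.top K F))}
    {f₂ : HomVectHom K (KerLam s (HomIdeal.top K F)) (KerLam m (HomIdeal.top K k))}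
    (h₁ : ∀ (a : Symb r (HomIdeal.top K F)) (ha : ExtProd.mk _ _ a ∈ KerLam r (HomIdeal.top K F)),
      (f₁ ⟨ExtProd.mk _ _ a, ha⟩ : ExtProd s (HomIdeal.top K F)) =
        ExtProd.mk _ _ (symMap (HomLeibnizHom.id K F) hrs hFF a))
    (h₂ : ∀ (a : Symb s (HomIdeal.top K F)) (ha : ExtProd.mk _ _ a ∈ KerLam s (HomIdeal.top K F)),
      (f₂ ⟨ExtProd.mk _ _ a, ha⟩ : ExtProd m (HomIdeal.top K k)) =
        ExtProd.mk _ _ (symMap π (fun x hx => (hs x).1 hx) hFk a)) :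
    Function.Exact f₁ f₂ := by
  have hpπ : Function.Surjective (p.toLinearMap ∘ₗ π.toLinearMap) := hp.comp hπ
  have hs' : ∀ x, x ∈ s.toSubmodule ↔ (p.toLinearMap ∘ₗ π.toLinearMap) x = 0 :=
    fun x => (hs x).trans (hm _)
  have cube_pπ : ∀ w, cubeMap (p.toLinearMap ∘ₗ π.toLinearMap) w =
      cubeMap p.toLinearMap (cubeMap π.toLinearMap w) := fun w => by
    have h : cubeMap (p.toLinearMap ∘ₗ π.toLinearMap) =
        cubeMap p.toLinearMap ∘ₗ cubeMap π.toLinearMap := by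
      ext x y z
      rfl
    exact LinearMap.congr_fun h w
  have sq_id : ∀ t, sqMap (HomLeibnizHom.id K F).toLinearMap t = t :=
    fun t => LinearMap.congr_fun TensorProduct.map_id t
  rintro ⟨y, hy⟩
  obtain ⟨b, rfl⟩ := Submodule.mkQ_surjective _ y
  rw [← Subtype.coe_inj, h₂ b hy]
  constructor
  · intro hb
    obtain ⟨w', hw', hwb⟩ := (mk_extProd_eq_zero hp hm).1 hb
    obtain ⟨w, rfl⟩ := cubeMap_surjective hπ w'
    rw [d3_cubeMap, symToTensor_symMap] at hwb
    -- Removing the lifted boundary leaves a tensor killed by `π ⊗ π`, that is, one coming from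
    -- symbols over `r`. The removed term is zero in `s ⋏ F`, because `w` is killed by the triple
    -- tensor power of `p π`.
    obtain ⟨c, hc⟩ := (sqMap_eq_zero (t := symToTensor _ _ b - d3 K F w) hπ hr).1 (by
      rw [map_sub, hwb, sub_self])
    have hz : mulMap K F (symToTensor _ _ c) = 0 := by
      rw [hc, map_sub, mulMap_d3, sub_zero]
      exact hy
    refine ⟨⟨ExtProd.mk _ _ c, hz⟩, Subtype.ext ?_⟩
    rw [h₁ c hz, ← sub_eq_zero, ← map_sub]
    refine (mk_extProd_eq_zero hpπ hs').2 ⟨-w, ?_, ?_⟩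
    · rw [map_neg, neg_eq_zero]
      exact (cube_pπ w).trans hw'
    · rw [map_sub, symToTensor_symMap, sq_id, hc, map_neg]
      abel
  · rintro ⟨⟨z, hz⟩, hzb⟩
    obtain ⟨c, rfl⟩ := Submodule.mkQ_surjective _ z
    have h := congrArg Subtype.val hzb
    rw [h₁ c hz] at h
    have h' := congrArg (fun x => (f₂ x : ExtProd m (HomIdeal.top K k))) hzb
    rw [← h₂ b hy, ← h']
    have hcy : ExtProd.mk _ _ (symMap (HomLeibnizHom.id K F) hrs hFF c) ∈
        KerLam s (HomIdeal.top K F) := by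
      rw [h]
      exact hy
    have e : f₁ ⟨ExtProd.mk _ _ c, hz⟩ = ⟨_, hcy⟩ := Subtype.ext (h₁ c hz)
    change (f₂ (f₁ ⟨ExtProd.mk _ _ c, hz⟩) : ExtProd m (HomIdeal.top K k)) = 0
    rw [e, h₂ _ hcy]
    refine (mk_extProd_eq_zero hp hm).2 ⟨0, map_zero _, ?_⟩
    rw [map_zero, symToTensor_symMap, symToTensor_symMap, sq_id, (sqMap_eq_zero hπ hr).2 ⟨c, rfl⟩]

/-- If the second homology of `F` vanishes, the map from the kernel for `s = π⁻¹(m)` covers the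
kernel of the map to the second homology of `k`. -/
lemma exact_kerLam_to_HL2 {F : Type*} [AddCommGroup F] [Module K F] [HomLeibniz K F]
    (hp : Function.Surjective p) (hm : ∀ x, x ∈ m.toSubmodule ↔ p x = 0)
    (hF : ∀ t : F ⊗[K] F, mulMap K F t = 0 → ∃ w, d3 K F w = t)
    {π : HomLeibnizHom K F k} (hπ : Function.Surjective π)
    {s : HomIdeal K F} (hs : ∀ x, x ∈ s.toSubmodule ↔ π x ∈ m.toSubmodule)
    {hFk : ∀ x ∈ (HomIdeal.top K F).toSubmodule, π x ∈ (HomIdeal.top K k).toSubmodule}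
    {f₂ : HomVectHom K (KerLam s (HomIdeal.top K F)) (KerLam m (HomIdeal.top K k))}
    {f₃ : HomVectHom K (KerLam m (HomIdeal.top K k)) (HL2 K k)}
    (h₂ : ∀ (a : Symb s (HomIdeal.top K F)) (ha : ExtProd.mk _ _ a ∈ KerLam s (HomIdeal.top K F)),
      (f₂ ⟨ExtProd.mk _ _ a, ha⟩ : ExtProd m (HomIdeal.top K k)) =
        ExtProd.mk _ _ (symMap π (fun x hx => (hs x).1 hx) hFk a))
    (h₃ : ∀ (a : Symb m (HomIdeal.top K k)) (ha : ExtProd.mk _ _ a ∈ KerLam m (HomIdeal.top K k))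
      (hz : symToTensor _ _ a ∈ Z2 K k),
      f₃ ⟨ExtProd.mk _ _ a, ha⟩ = HL2.mk K k ⟨symToTensor _ _ a, hz⟩) :
    Function.Exact f₂ f₃ := by
  have hpπ : Function.Surjective (p.toLinearMap ∘ₗ π.toLinearMap) := hp.comp hπ
  have hs' : ∀ x, x ∈ s.toSubmodule ↔ (p.toLinearMap ∘ₗ π.toLinearMap) x = 0 :=
    fun x => (hs x).trans (hm _)
  rintro ⟨y, hy⟩
  obtain ⟨a, rfl⟩ := Submodule.mkQ_surjective _ y
  rw [h₃ a hy (mem_Z2.2 hy), mk_HL2_eq_zero]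
  constructor
  · rintro ⟨w', hw'⟩
    obtain ⟨w, rfl⟩ := cubeMap_surjective hπ w'
    rw [d3_cubeMap] at hw'
    -- The preimage is the boundary of a lift of `w'` to `F`: it has product zero and dies in `g ⊗
    -- g`, so it comes from symbols over `s`.
    obtain ⟨b, hb⟩ := (sqMap_eq_zero (t := d3 K F w) hpπ hs').1 (by
      rw [TensorProduct.map_comp, LinearMap.comp_apply, hw']
      exact (sqMap_eq_zero hp hm).2 ⟨a, rfl⟩)
    have hz : mulMap K F (symToTensor _ _ b) = 0 := by rw [hb, mulMap_d3]
    refine ⟨⟨ExtProd.mk _ _ b, hz⟩, Subtype.ext ?_⟩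
    rw [h₂ b hz]
    rw [← sub_eq_zero, ← map_sub]
    refine (mk_extProd_eq_zero hp hm).2 ⟨0, map_zero _, ?_⟩
    rw [map_zero, map_sub, symToTensor_symMap, hb, hw', sub_self]
  · rintro ⟨⟨z, hz⟩, hza⟩
    obtain ⟨b, rfl⟩ := Submodule.mkQ_surjective _ z
    -- The only use of the vanishing homology of `F`: it is needed for the composite to be zero, not
    -- for the preceding inclusion.
    obtain ⟨w, hw⟩ := hF (symToTensor _ _ b) hz
    have h := congrArg Subtype.val hza
    rw [h₂ b hz, ← sub_eq_zero, ← map_sub] at h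
    obtain ⟨v, -, hv⟩ := (mk_extProd_eq_zero hp hm).1 h
    refine ⟨cubeMap π.toLinearMap w - v, ?_⟩
    rw [map_sub, hv, d3_cubeMap, hw, map_sub, symToTensor_symMap]
    exact sub_sub_cancel _ _

/-- A cycle whose image bounds is changed by a lifted boundary into one killed by `p ⊗ p`, which
then comes from symbols. -/
lemma exact_HL2_map
    (hp : Function.Surjective p) (hm : ∀ x, x ∈ m.toSubmodule ↔ p x = 0)
    {f₃ : HomVectHom K (KerLam m (HomIdeal.top K k)) (HL2 K k)}
    {f₄ : HomVectHom K (HL2 K k) (HL2 K g)}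
    (h₃ : ∀ (a : Symb m (HomIdeal.top K k)) (ha : ExtProd.mk _ _ a ∈ KerLam m (HomIdeal.top K k))
      (hz : symToTensor _ _ a ∈ Z2 K k),
      f₃ ⟨ExtProd.mk _ _ a, ha⟩ = HL2.mk K k ⟨symToTensor _ _ a, hz⟩)
    (h₄ : ∀ (t : Z2 K k) (hz : sqMap p.toLinearMap (t : k ⊗[K] k) ∈ Z2 K g),
      f₄ (HL2.mk K k t) = HL2.mk K g ⟨_, hz⟩) :
    Function.Exact f₃ f₄ := by
  intro x
  obtain ⟨⟨t, ht⟩, rfl⟩ := Submodule.mkQ_surjective _ x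
  rw [h₄ ⟨t, ht⟩ (sqMap_mem_Z2 p ht), mk_HL2_eq_zero]
  constructor
  · rintro ⟨w', hw'⟩
    obtain ⟨w, rfl⟩ := cubeMap_surjective hp w'
    rw [d3_cubeMap] at hw'
    obtain ⟨a, ha⟩ := (sqMap_eq_zero (t := t - d3 K k w) hp hm).1 (by rw [map_sub, hw']; exact sub_self _)
    have hz : mulMap K k (symToTensor _ _ a) = 0 := by
      rw [ha, map_sub, mulMap_d3, sub_zero, mem_Z2.1 ht]
    refine ⟨⟨ExtProd.mk _ _ a, hz⟩, ?_⟩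
    rw [h₃ a hz (mem_Z2.2 hz), ← sub_eq_zero, ← map_sub]
    exact mk_HL2_eq_zero.2 ⟨-w, by simp [ha]⟩
  · rintro ⟨⟨y, hy⟩, hyt⟩
    obtain ⟨a, rfl⟩ := Submodule.mkQ_surjective _ y
    rw [h₃ a hy (mem_Z2.2 hy), ← sub_eq_zero, ← map_sub] at hyt
    obtain ⟨w, hw⟩ := mk_HL2_eq_zero.1 hyt
    refine ⟨-cubeMap p.toLinearMap w, ?_⟩
    rw [map_neg, d3_cubeMap, hw]
    simp [(sqMap_eq_zero hp hm).2 ⟨a, rfl⟩]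

/-- If the product of `t` is also the product of a combination of symbols, subtracting the tensor of
that combination makes `t` a cycle without moving its image under `p ⊗ p`. -/
lemma exact_connecting
    (hp : Function.Surjective p) (hm : ∀ x, x ∈ m.toSubmodule ↔ p x = 0)
    {f₄ : HomVectHom K (HL2 K k) (HL2 K g)}
    {f₅ : HomVectHom K (HL2 K g) (ModComm m)}
    (h₄ : ∀ (t : Z2 K k) (hz : sqMap p.toLinearMap (t : k ⊗[K] k) ∈ Z2 K g),
      f₄ (HL2.mk K k t) = HL2.mk K g ⟨_, hz⟩)
    (h₅ : ∀ (t : k ⊗[K] k) (hz : sqMap p.toLinearMap t ∈ Z2 K g)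
      (ht : mulMap K k t ∈ m.toSubmodule),
      f₅ (HL2.mk K g ⟨_, hz⟩) = Submodule.Quotient.mk ⟨mulMap K k t, ht⟩) :
    Function.Exact f₄ f₅ := by
  intro x
  obtain ⟨⟨t', ht'⟩, rfl⟩ := Submodule.mkQ_surjective _ x
  obtain ⟨t, rfl⟩ := TensorProduct.map_surjective hp hp t'
  have htm : mulMap K k t ∈ m.toSubmodule := (hm _).2 (by
    rw [← mulMap_sqMap]
    exact mem_Z2.1 ht')
  rw [h₅ t ht' htm, mk_modComm_eq_zero]
  constructor
  · rintro ⟨a, ha⟩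
    have hz : t - symToTensor _ _ a ∈ Z2 K k := by
      rw [mem_Z2, map_sub, ha]
      exact sub_self _
    refine ⟨HL2.mk K k ⟨_, hz⟩, ?_⟩
    rw [h₄ _ (sqMap_mem_Z2 p hz)]
    refine congrArg (HL2.mk K g) (Subtype.ext ?_)
    change sqMap p.toLinearMap (t - symToTensor _ _ a) = _
    rw [map_sub, (sqMap_eq_zero hp hm).2 ⟨a, rfl⟩, sub_zero]
  · rintro ⟨y, hy⟩
    obtain ⟨⟨z, hz⟩, rfl⟩ := Submodule.mkQ_surjective _ y
    rw [h₄ _ (sqMap_mem_Z2 p hz)] at hy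
    have h := congrArg f₅.toLinearMap hy
    have hzm : mulMap K k z ∈ m.toSubmodule := by
      rw [mem_Z2.1 hz]
      exact zero_mem _
    rw [h₅ z (sqMap_mem_Z2 p hz) hzm] at h
    have h' := h.trans (h₅ t ht' htm)
    rw [← mk_modComm_eq_zero, ← h']
    exact (congrArg _ (Subtype.ext (mem_Z2.1 hz))).trans (Submodule.Quotient.mk_zero _)

lemma exact_modComm_to_HL1
    (hp : Function.Surjective p) (hm : ∀ x, x ∈ m.toSubmodule ↔ p x = 0)
    {f₅ : HomVectHom K (HL2 K g) (ModComm m)}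
    {f₆ : HomVectHom K (ModComm m) (HL1 K k)}
    (h₅ : ∀ (t : k ⊗[K] k) (hz : sqMap p.toLinearMap t ∈ Z2 K g)
      (ht : mulMap K k t ∈ m.toSubmodule),
      f₅ (HL2.mk K g ⟨_, hz⟩) = Submodule.Quotient.mk ⟨mulMap K k t, ht⟩)
    (h₆ : ∀ x : m.toSubmodule, f₆ (Submodule.Quotient.mk x) = Submodule.Quotient.mk (x : k)) :
    Function.Exact f₅ f₆ := by
  intro x
  obtain ⟨x, rfl⟩ := Submodule.mkQ_surjective _ x
  change f₆ (Submodule.Quotient.mk x) = 0 ↔ _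
  rw [h₆, Submodule.Quotient.mk_eq_zero]
  constructor
  · rintro ⟨t, ht⟩
    -- The sign compensates for `d2` being minus the product.
    have hx : mulMap K k (-t) = x := by
      rw [← ht, map_neg]
      rfl
    have hxm : mulMap K k (-t) ∈ m.toSubmodule := hx ▸ x.2
    have hz : sqMap p.toLinearMap (-t) ∈ Z2 K g := by
      rw [mem_Z2, mulMap_sqMap]
      exact (hm _).1 hxm
    exact ⟨HL2.mk K g ⟨_, hz⟩, (h₅ _ hz hxm).trans (congrArg _ (Subtype.ext hx))⟩
  · rintro ⟨y, hy⟩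
    obtain ⟨⟨t', ht'⟩, rfl⟩ := Submodule.mkQ_surjective _ y
    obtain ⟨t, rfl⟩ := TensorProduct.map_surjective hp hp t'
    have htm : mulMap K k t ∈ m.toSubmodule := (hm _).2 (by
      rw [← mulMap_sqMap]
      exact mem_Z2.1 ht')
    have h := (h₅ t ht' htm).symm.trans hy
    obtain ⟨a, ha⟩ := mk_modComm_eq_zero.1
      ((map_sub (Submodule.mkQ _) _ _).trans (sub_eq_zero.2 h))
    refine ⟨symToTensor _ _ a - t, ?_⟩
    rw [d2, LinearMap.neg_apply, map_sub, ha]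
    simp

lemma exact_HL1_map
    (hp : Function.Surjective p) (hm : ∀ x, x ∈ m.toSubmodule ↔ p x = 0)
    {f₆ : HomVectHom K (ModComm m) (HL1 K k)}
    {f₇ : HomVectHom K (HL1 K k) (HL1 K g)}
    (h₆ : ∀ x : m.toSubmodule, f₆ (Submodule.Quotient.mk x) = Submodule.Quotient.mk (x : k))
    (h₇ : ∀ x : k, f₇ (Submodule.Quotient.mk x) = Submodule.Quotient.mk (p x)) :
    Function.Exact f₆ f₇ := by
  intro x
  obtain ⟨x, rfl⟩ := Submodule.mkQ_surjective _ x
  change f₇ (Submodule.Quotient.mk x) = 0 ↔ _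
  rw [h₇, Submodule.Quotient.mk_eq_zero]
  have d2_p : ∀ t, d2 K g (sqMap p.toLinearMap t) = p (d2 K k t) := fun t => by
    rw [d2, d2, LinearMap.neg_apply, LinearMap.neg_apply, mulMap_sqMap, map_neg]
  constructor
  · rintro ⟨t', ht'⟩
    obtain ⟨t, rfl⟩ := TensorProduct.map_surjective hp hp t'
    rw [d2_p] at ht'
    have hx : x - d2 K k t ∈ m.toSubmodule := (hm _).2 (by rw [map_sub, ht', sub_self])
    refine ⟨Submodule.Quotient.mk ⟨_, hx⟩, ?_⟩
    rw [h₆]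
    exact (Submodule.Quotient.eq _).2 ⟨-t, by simp⟩
  · rintro ⟨y, hy⟩
    obtain ⟨y, rfl⟩ := Submodule.mkQ_surjective _ y
    obtain ⟨t, ht⟩ := (Submodule.Quotient.eq _).1 ((h₆ y).symm.trans hy)
    refine ⟨-sqMap p.toLinearMap t, ?_⟩
    rw [map_neg, d2_p, ht, map_sub, (hm _).1 y.2]
    simp

lemma injective_and_surjective_of_split
    (hp : Function.Surjective p) (hm : ∀ x, x ∈ m.toSubmodule ↔ p x = 0)
    {η : HomLeibnizHom K g k} (hη : ∀ y, p (η y) = y)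
    {f₃ : HomVectHom K (KerLam m (HomIdeal.top K k)) (HL2 K k)}
    {f₄ : HomVectHom K (HL2 K k) (HL2 K g)}
    (h₃ : ∀ (a : Symb m (HomIdeal.top K k)) (ha : ExtProd.mk _ _ a ∈ KerLam m (HomIdeal.top K k))
      (hz : symToTensor _ _ a ∈ Z2 K k),
      f₃ ⟨ExtProd.mk _ _ a, ha⟩ = HL2.mk K k ⟨symToTensor _ _ a, hz⟩)
    (h₄ : ∀ (t : Z2 K k) (hz : sqMap p.toLinearMap (t : k ⊗[K] k) ∈ Z2 K g),
      f₄ (HL2.mk K k t) = HL2.mk K g ⟨_, hz⟩) :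
    Function.Injective f₃ ∧ Function.Surjective f₄ := by
  have sq_η : ∀ t, sqMap p.toLinearMap (sqMap η.toLinearMap t) = t := fun t => by
    have h : sqMap p.toLinearMap ∘ₗ sqMap η.toLinearMap = LinearMap.id := by
      ext x y
      simp [hη]
    exact LinearMap.congr_fun h t
  have cube_η : ∀ w, cubeMap p.toLinearMap (cubeMap η.toLinearMap w) = w := fun w => by
    have h : cubeMap p.toLinearMap ∘ₗ cubeMap η.toLinearMap = LinearMap.id := by
      ext x y z
      simp [hη]
    exact LinearMap.congr_fun h w
  refine ⟨(injective_iff_map_eq_zero f₃.toLinearMap).2 ?_, ?_⟩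
  · rintro ⟨y, hy⟩ h
    obtain ⟨a, rfl⟩ := Submodule.mkQ_surjective _ y
    rw [h₃ a hy (mem_Z2.2 hy), mk_HL2_eq_zero] at h
    obtain ⟨w, hw⟩ := h
    -- The chain section `η` moves `w` into the relative complex. The boundary is unchanged, because
    -- `p ⊗ p` kills the tensor of `a`.
    refine Subtype.ext ((mk_extProd_eq_zero hp hm).2
      ⟨w - cubeMap η.toLinearMap (cubeMap p.toLinearMap w), ?_, ?_⟩)
    · rw [map_sub]
      exact sub_eq_zero.2 (cube_η _).symm
    · rw [map_sub, d3_cubeMap, d3_cubeMap, hw, (sqMap_eq_zero hp hm).2 ⟨a, rfl⟩, map_zero, sub_zero]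
  · intro y
    obtain ⟨⟨t, ht⟩, rfl⟩ := Submodule.mkQ_surjective _ y
    have hz : sqMap η.toLinearMap t ∈ Z2 K k := by
      rw [mem_Z2, mulMap_sqMap, mem_Z2.1 ht, map_zero]
    refine ⟨HL2.mk K k ⟨_, hz⟩, ?_⟩
    rw [h₄ _ (sqMap_mem_Z2 p hz)]
    exact congrArg (HL2.mk K g) (Subtype.ext (sq_η t))

end Exactness

end HomLeib

theorem theorem4p7 {K : Type*} [Field K]
    {k : Type*} [AddCommGroup k] [Module K k] [HomLeibniz K k]
    {g : Type*} [AddCommGroup g] [Module K g] [HomLeibniz K g]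
    {F : Type u} [AddCommGroup F] [Module K F] [HomLeibniz K F]
    -- the extension `m ↣ k ↠ g`
    (p : HomLeibnizHom K k g) (hp : Function.Surjective p)
    (m : HomIdeal K k) (hm : ∀ x, x ∈ m.toSubmodule ↔ p x = 0)
    -- the free presentation `r ↣ F ↠ k`
    (hF : IsFreeHomLeibniz K F)
    (π : HomLeibnizHom K F k) (hπ : Function.Surjective π)
    (r : HomIdeal K F) (hr : ∀ x, x ∈ r.toSubmodule ↔ π x = 0)
    -- the ideal `s` of `F` with `m ≅ s / r` (induced by `k ≅ F / r`)
    (s : HomIdeal K F) (hs : ∀ x, x ∈ s.toSubmodule ↔ π x ∈ m.toSubmodule) :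
    ∃ (f₁ : HomVectHom K (KerLam r (HomIdeal.top K F)) (KerLam s (HomIdeal.top K F)))
      (f₂ : HomVectHom K (KerLam s (HomIdeal.top K F)) (KerLam m (HomIdeal.top K k)))
      (f₃ : HomVectHom K (KerLam m (HomIdeal.top K k)) (HL2 K k))
      (f₄ : HomVectHom K (HL2 K k) (HL2 K g))
      (f₅ : HomVectHom K (HL2 K g) (ModComm m))
      (f₆ : HomVectHom K (ModComm m) (HL1 K k))
      (f₇ : HomVectHom K (HL1 K k) (HL1 K g)),
      -- `f₁` and `f₂` are induced by the inclusion of `r` in `s` and by `π`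
      (∀ (a : Symb r (HomIdeal.top K F)) (ha : ExtProd.mk _ _ a ∈ KerLam r (HomIdeal.top K F)),
        (f₁ ⟨ExtProd.mk _ _ a, ha⟩ : ExtProd s (HomIdeal.top K F)) =
          ExtProd.mk _ _ (symMap (HomLeibnizHom.id K F)
            (fun x hx => (hs x).2 (((hr x).1 hx).symm ▸ m.zero_mem))
            (fun _ _ => Submodule.mem_top) a)) ∧
      (∀ (a : Symb s (HomIdeal.top K F)) (ha : ExtProd.mk _ _ a ∈ KerLam s (HomIdeal.top K F)),
        (f₂ ⟨ExtProd.mk _ _ a, ha⟩ : ExtProd m (HomIdeal.top K k)) =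
          ExtProd.mk _ _ (symMap π (fun x hx => (hs x).1 hx)
            (fun _ _ => Submodule.mem_top) a)) ∧
      -- `f₃` sends the class of a combination of symbols to the class of the same tensor
      (∀ (a : Symb m (HomIdeal.top K k)) (ha : ExtProd.mk _ _ a ∈ KerLam m (HomIdeal.top K k))
          (hz : symToTensor _ _ a ∈ Z2 K k),
        f₃ ⟨ExtProd.mk _ _ a, ha⟩ = HL2.mk K k ⟨symToTensor _ _ a, hz⟩) ∧
      -- `f₄` is induced by `p`
      (∀ (t : Z2 K k)
          (hz : TensorProduct.map p.toLinearMap p.toLinearMap (t : k ⊗[K] k) ∈ Z2 K g),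
        f₄ (HL2.mk K k t) = HL2.mk K g ⟨_, hz⟩) ∧
      -- `f₅` is the connecting homomorphism
      (∀ (t : k ⊗[K] k)
          (hz : TensorProduct.map p.toLinearMap p.toLinearMap t ∈ Z2 K g)
          (ht : mulMap K k t ∈ m.toSubmodule),
        f₅ (HL2.mk K g ⟨_, hz⟩) = Submodule.Quotient.mk ⟨mulMap K k t, ht⟩) ∧
      -- `f₆` and `f₇` are induced by the inclusion of `m` in `k` and by `p`
      (∀ x : m.toSubmodule,
        f₆ (Submodule.Quotient.mk x) = Submodule.Quotient.mk (x : k)) ∧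
      (∀ x : k, f₇ (Submodule.Quotient.mk x) = Submodule.Quotient.mk (p x)) ∧
      -- exactness
      Function.Exact f₁ f₂ ∧ Function.Exact f₂ f₃ ∧ Function.Exact f₃ f₄ ∧
      Function.Exact f₄ f₅ ∧ Function.Exact f₅ f₆ ∧ Function.Exact f₆ f₇ ∧
      Function.Surjective f₇ ∧
      -- the split case
      ((∃ η : HomLeibnizHom K g k, ∀ y, p (η y) = y) →
        Function.Injective f₃ ∧ Function.Exact f₃ f₄ ∧ Function.Surjective f₄) := by
  obtain ⟨f₁, h₁⟩ := exists_kerLam_map (M := r) (N := HomIdeal.top K F) (HomLeibnizHom.id K F)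
    (M' := s) (N' := HomIdeal.top K F)
    (fun x hx => (hs x).2 (((hr x).1 hx).symm ▸ m.zero_mem)) (fun _ _ => Submodule.mem_top)
  obtain ⟨f₂, h₂⟩ := exists_kerLam_map (M := s) (N := HomIdeal.top K F) π
    (M' := m) (N' := HomIdeal.top K k) (fun x hx => (hs x).1 hx) (fun _ _ => Submodule.mem_top)
  obtain ⟨f₃, h₃⟩ := exists_kerLam_to_HL2 hp hm
  obtain ⟨f₄, h₄⟩ := exists_HL2_map p
  obtain ⟨f₅, h₅⟩ := exists_connecting hp hm
  obtain ⟨f₆, h₆⟩ := exists_modComm_to_HL1 (M := m)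
  obtain ⟨f₇, h₇⟩ := exists_HL1_map p
  have exact₃₄ := exact_HL2_map hp hm h₃ h₄
  refine ⟨f₁, f₂, f₃, f₄, f₅, f₆, f₇, h₁, h₂, h₃, h₄, h₅, h₆, h₇,
    exact_kerLam_map hp hm hπ hr hs h₁ h₂,
    exact_kerLam_to_HL2 hp hm (fun _ => hF.exists_d3_eq) hπ hs h₂ h₃, exact₃₄,
    exact_connecting hp hm h₄ h₅, exact_modComm_to_HL1 hp hm h₅ h₆, exact_HL1_map hp hm h₆ h₇,
    ?_, ?_⟩
  · intro y
    obtain ⟨y, rfl⟩ := Submodule.mkQ_surjective _ y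
    obtain ⟨x, rfl⟩ := hp y
    exact ⟨_, h₇ x⟩
  · rintro ⟨η, hη⟩
    obtain ⟨hinj, hsurj⟩ := injective_and_surjective_of_split hp hm hη h₃ h₄
    exact ⟨hinj, exact₃₄, hsurj⟩
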